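/- Let $H$ be a fixed finite tree and let $c>0$ and $A<1$ be real constants. For integers $n,m\ge 0$ let $\mathcal P(n,m)$ be the set of all simple planar graphs on the vertex set $\{1,\dots,n\}$ with exactly $m$ edges, and, when this set is nonempty, let $P_{n,m}$ be a graph chosen uniformly at random from it. Then there exists a constant $\lambda=\lambda(H,c,A)>0$ such that the following holds for every integer-valued function $m=m(n)\ge 0$ with $cn\le m(n)\le An$ for all sufficiently large $n$: for all sufficiently large $n$, the set $\mathcal P(n,m(n))$ is nonempty and $$\mathbf P\bigl[P_{n,m(n)}\text{ has fewer than }\lambda n\text{ connected components isomorphic to }H\bigr]<e^{-\lambda n}.$$ -/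

import Mathlib

/-- A drawing of the graph `G` in the Euclidean plane without crossings: the vertices are distinct
points, every edge `uv` is a simple (continuous, injective) arc joining the points of `u` and `v`,
and the interior of an arc contains no vertex and no interior point of another arc. -/
structure PlaneEmbedding {V : Type*} (G : SimpleGraph V) where
  /-- the point that represents a vertex -/
  point : V → EuclideanSpace ℝ (Fin 2)
  point_injective : Function.Injective point
  /-- the arc that represents an edge (parametrised in one of its two directions) -/
  arc : G.edgeSet → C(unitInterval, EuclideanSpace ℝ (Fin 2))
  arc_injective : ∀ e, Function.Injective (arc e)
  arc_ends : ∀ e, s(arc e 0, arc e 1) = Sym2.map point e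
  arc_ne_point : ∀ e, ∀ t ∈ Set.Ioo (0 : unitInterval) 1, ∀ v, arc e t ≠ point v
  arc_ne_arc : ∀ e f, e ≠ f → ∀ s ∈ Set.Ioo (0 : unitInterval) 1,
    ∀ t ∈ Set.Ioo (0 : unitInterval) 1, arc e s ≠ arc f t

/-- A graph is planar if it can be drawn in the plane without crossings. -/
def IsPlanarGraph {V : Type*} (G : SimpleGraph V) : Prop :=
  Nonempty (PlaneEmbedding G)

/-- The set of all (labelled, simple) planar graphs on `n` vertices with exactly `m` edges. -/
def planarGraphs (n m : ℕ) : Set (SimpleGraph (Fin n)) :=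
  {G | IsPlanarGraph G ∧ G.edgeSet.ncard = m}

/-- The probability that a uniformly random element of `planarGraphs n m` has the property `Q`
(meaningful when `planarGraphs n m` is nonempty). -/
noncomputable def planarProb (n m : ℕ) (Q : SimpleGraph (Fin n) → Prop) : ℝ :=
  ({G ∈ planarGraphs n m | Q G}.ncard : ℝ) / ((planarGraphs n m).ncard : ℝ)

/-- The number of connected components of `G` that are isomorphic to `H`. -/
noncomputable def isoComponentCount {V W : Type*} (H : SimpleGraph W) (G : SimpleGraph V) : ℕ :=
  {C : G.ConnectedComponent | Nonempty (C.toSimpleGraph ≃g H)}.ncard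

/-!
The proof compares classes of planar graphs by edge swaps `G ↦ G - xy + ab`, which keep the number of
vertices and of edges. A swap preserves planarity whenever `a` and `b` lie in different components
of `G` that are both trees (`IsPlanarGraph.sup_edge`): the two trees and the new edge form a tree,
and a forest can be drawn next to any plane graph with straight edges, one leaf at a time
(`PlaneEmbedding.exists_sup_forest`).

A graph with `n` vertices and `m ≤ A * n` edges has at least `n - m ≥ (1 - A) * n` tree components.

* Isolated vertices are abundant. If `G` has few of them, then it has linearly many leaves, since the
  degrees add up to `2 * m`. Cut off a leaf `v` from its neighbour `u` and join two tree components
  by an edge `ab`: there are of order `n ^ 3` such swaps. To undo one, choose `v` among the isolated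
  vertices of the result, `u` arbitrarily and `ab` among the edges: at most `2 * δ * n ^ 3` choices if
  there are at most `δ * n` isolated vertices.
* Copies of a tree `H` are abundant, by induction on `H`. Let `l` be a leaf of `H`. Hang an isolated
  vertex on a component isomorphic to `H - l` and delete an arbitrary edge `xy`. Abundance of the
  copies of `H - l` and of isolated vertices, together with `m ≥ c * n`, gives of order `n ^ 3` swaps.
  To undo one, choose the hung vertex, which lies in a copy of `H`, and `x`, `y` arbitrarily: again at
  most `δ * n ^ 3` choices if there are few copies of `H`.

Since a swap changes all relevant counts by a bounded amount, about `lam * n` swaps can be chained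
(`ncard_le_exp_mul_of_chain`). Each link multiplies the size of the class by at least `8`, so that
the class of graphs with too few copies is exponentially small among all planar graphs.
-/

open SimpleGraph Set

/-! ### Planarity: drawing a forest next to a plane graph -/

lemma IsPlanarGraph.mono {V : Type*} {G G' : SimpleGraph V} (hle : G ≤ G')
    (h : IsPlanarGraph G') : IsPlanarGraph G := by
  obtain ⟨E⟩ := h
  have hsub : ∀ e : G.edgeSet, e.1 ∈ G'.edgeSet := fun e => SimpleGraph.edgeSet_mono hle e.2
  exact ⟨{
    point := E.point
    point_injective := E.point_injective
    arc := fun e => E.arc ⟨e.1, hsub e⟩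
    arc_injective := fun e => E.arc_injective _
    arc_ends := fun e => E.arc_ends ⟨e.1, hsub e⟩
    arc_ne_point := fun e => E.arc_ne_point _
    arc_ne_arc := fun e f hef => E.arc_ne_arc _ _ (by
      intro h; exact hef (Subtype.ext (by simpa using h))) }⟩

lemma isPlanarGraph_bot_fin (n : ℕ) : IsPlanarGraph (⊥ : SimpleGraph (Fin n)) := by
  have hno : ∀ e : (⊥ : SimpleGraph (Fin n)).edgeSet, False := fun e => by simpa using e.2
  exact ⟨{
    point := fun i => !₂[(i : ℝ), 0]
    point_injective := by
      intro i j h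
      have := congrArg (fun p : EuclideanSpace ℝ (Fin 2) => p 0) h
      simpa [Fin.ext_iff] using this
    arc := fun e => (hno e).elim
    arc_injective := fun e => (hno e).elim
    arc_ends := fun e => (hno e).elim
    arc_ne_point := fun e => (hno e).elim
    arc_ne_arc := fun e => (hno e).elim }⟩

/-- An arc is straight if it runs along the segment between its ends at constant speed. -/
def IsStraightArc (γ : C(unitInterval, EuclideanSpace ℝ (Fin 2))) : Prop :=
  ∀ t : unitInterval, γ t = AffineMap.lineMap (γ 0) (γ 1) (t : ℝ)

/-- The plane is not a union of finitely many lines through the origin. -/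
lemma exists_forall_notMem_span {ι : Type*} [Finite ι] (f : ι → EuclideanSpace ℝ (Fin 2)) :
    ∃ d : EuclideanSpace ℝ (Fin 2), ∀ i, d ∉ Submodule.span ℝ {f i} := by
  classical
  cases nonempty_fintype ι
  let s : Finset (Submodule ℝ (EuclideanSpace ℝ (Fin 2))) :=
    Finset.univ.image fun i => Submodule.span ℝ {f i}
  have htop : (⊤ : Submodule ℝ (EuclideanSpace ℝ (Fin 2))) ∉ s := by
    intro h
    obtain ⟨i, -, hi⟩ := Finset.mem_image.1 h
    have h1 := finrank_span_le_card (R := ℝ) ({f i} : Set (EuclideanSpace ℝ (Fin 2)))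
    rw [hi] at h1
    simp at h1
  have h := Subspace.biUnion_ne_univ_of_top_notMem htop
  obtain ⟨d, hd⟩ := (Set.ne_univ_iff_exists_notMem _).1 h
  refine ⟨d, fun i hi => hd ?_⟩
  simp only [Set.mem_iUnion]
  exact ⟨_, Finset.mem_image.2 ⟨i, Finset.mem_univ _, rfl⟩, hi⟩

namespace PlaneEmbedding

variable {V : Type*} {K : SimpleGraph V}

lemma arc_zero_mem (E : PlaneEmbedding K) (e : K.edgeSet) :
    ∃ w ∈ e.1, E.arc e 0 = E.point w := by
  have h : E.arc e 0 ∈ Sym2.map E.point e := by rw [← E.arc_ends e]; simp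
  obtain ⟨w, hw, h⟩ := Sym2.mem_map.1 h
  exact ⟨w, hw, h.symm⟩

lemma arc_one_mem (E : PlaneEmbedding K) (e : K.edgeSet) :
    ∃ w ∈ e.1, E.arc e 1 = E.point w := by
  have h : E.arc e 1 ∈ Sym2.map E.point e := by rw [← E.arc_ends e]; simp
  obtain ⟨w, hw, h⟩ := Sym2.mem_map.1 h
  exact ⟨w, hw, h.symm⟩

lemma arc_ne_point_of_notMem (E : PlaneEmbedding K) {e : K.edgeSet} {v : V} (hv : v ∉ e.1)
    (t : unitInterval) : E.arc e t ≠ E.point v := by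
  intro h
  rcases eq_or_ne t 0 with rfl | h0
  · obtain ⟨w, hw, h'⟩ := E.arc_zero_mem e
    exact hv (E.point_injective (h.symm.trans h') ▸ hw)
  rcases eq_or_ne t 1 with rfl | h1
  · obtain ⟨w, hw, h'⟩ := E.arc_one_mem e
    exact hv (E.point_injective (h.symm.trans h') ▸ hw)
  exact E.arc_ne_point e t ⟨unitInterval.pos_iff_ne_zero.2 h0, unitInterval.lt_one_iff_ne_one.2 h1⟩
    v h

lemma sub_mem_span_of_isStraightArc (E : PlaneEmbedding K) {e : K.edgeSet} {v : V} (hv : v ∈ e.1)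
    (hs : IsStraightArc (E.arc e)) :
    ∃ w, ∀ t, E.arc e t - E.point v ∈ Submodule.span ℝ {E.point w - E.point v} := by
  have h : E.point v ∈ s(E.arc e 0, E.arc e 1) := by
    rw [E.arc_ends e]; exact Sym2.mem_map.2 ⟨v, hv, rfl⟩
  rcases Sym2.mem_iff.1 h with h | h
  · obtain ⟨w, -, hw⟩ := E.arc_one_mem e
    refine ⟨w, fun t => ?_⟩
    rw [hs t, ← hw, h]
    refine Submodule.mem_span_singleton.2 ⟨t, ?_⟩
    rw [AffineMap.lineMap_apply_module]
    module
  · obtain ⟨w, -, hw⟩ := E.arc_zero_mem e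
    refine ⟨w, fun t => ?_⟩
    rw [hs t, ← hw, h]
    refine Submodule.mem_span_singleton.2 ⟨1 - t, ?_⟩
    rw [AffineMap.lineMap_apply_module]
    module

/-- If all arcs at `v` are straight, then some segment starting at `v` meets the drawing in `v` only:
its direction differs from those of the arcs at `v`, and it is too short to reach anything else. -/
lemma exists_free_segment [Finite V] (E : PlaneEmbedding K) (v : V)
    (hv : ∀ e : K.edgeSet, v ∈ e.1 → IsStraightArc (E.arc e)) :
    ∃ d : EuclideanSpace ℝ (Fin 2), d ≠ 0 ∧ ∀ r : ℝ, 0 < r → r ≤ 1 →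
      (∀ w, E.point w ≠ E.point v + r • d) ∧ ∀ e t, E.arc e t ≠ E.point v + r • d := by
  obtain ⟨d, hd⟩ := exists_forall_notMem_span fun w => E.point w - E.point v
  have hd0 : d ≠ 0 := fun h => hd v (h ▸ Submodule.zero_mem _)
  have hd' : ∀ w, ∀ s : ℝ, s ≠ 0 → s • d ∉ Submodule.span ℝ {E.point w - E.point v} :=
    fun w s hs h => hd w ((Submodule.smul_mem_iff _ hs).1 h)
  have hfin : Finite K.edgeSet := inferInstance
  let B : Set (EuclideanSpace ℝ (Fin 2)) := ⋃ e : {e : K.edgeSet // v ∉ e.1}, range (E.arc e.1)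
  have hB : IsClosed B := isClosed_iUnion_of_finite fun e =>
    (isCompact_range (E.arc e.1).continuous).isClosed
  have hvB : E.point v ∈ Bᶜ := by
    intro h
    obtain ⟨e, t, h⟩ := mem_iUnion.1 h
    exact E.arc_ne_point_of_notMem e.2 t h
  obtain ⟨ε, hε, hball⟩ := Metric.isOpen_iff.1 hB.isOpen_compl _ hvB
  have hnd : 0 < ‖d‖ := norm_pos_iff.2 hd0
  have hδ : 0 < ε / (2 * ‖d‖) := by positivity
  refine ⟨(ε / (2 * ‖d‖)) • d, smul_ne_zero hδ.ne' hd0, fun r hr hr1 => ⟨fun w h => ?_, ?_⟩⟩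
  · refine hd' w (r * (ε / (2 * ‖d‖))) (by positivity) ?_
    rw [h, mul_smul, add_sub_cancel_left]
    exact Submodule.mem_span_singleton_self _
  · intro e t h
    by_cases hve : v ∈ e.1
    · obtain ⟨w, hw⟩ := E.sub_mem_span_of_isStraightArc hve (hv e hve)
      refine hd' w (r * (ε / (2 * ‖d‖))) (by positivity) ?_
      have := hw t
      rwa [h, add_sub_cancel_left, ← mul_smul] at this
    · refine hball (a := E.point v + r • (ε / (2 * ‖d‖)) • d) ?_
        (mem_iUnion.2 ⟨⟨e, hve⟩, t, h⟩)
      rw [Metric.mem_ball, dist_eq_norm, add_sub_cancel_left, norm_smul, norm_smul, Real.norm_of_nonneg hr.le,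
        Real.norm_of_nonneg hδ.le]
      have : ε / (2 * ‖d‖) * ‖d‖ = ε / 2 := by field_simp
      rw [this]
      nlinarith

/-- An isolated vertex `l` can be redrawn close to `v` and joined to it by a straight edge, provided
that all arcs at `v` are straight. For arbitrary arcs this would require taming their behaviour
near `v`. -/
lemma exists_sup_edge [Finite V] (E : PlaneEmbedding K) {l v : V} (hlv : l ≠ v)
    (hl : ∀ w, ¬ K.Adj l w) (hv : ∀ e : K.edgeSet, v ∈ e.1 → IsStraightArc (E.arc e)) :
    ∃ E' : PlaneEmbedding (K ⊔ SimpleGraph.edge l v),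
      (∀ e (he : e ∈ K.edgeSet) (he' : e ∈ (K ⊔ SimpleGraph.edge l v).edgeSet),
        E'.arc ⟨e, he'⟩ = E.arc ⟨e, he⟩) ∧
      ∀ he : s(l, v) ∈ (K ⊔ SimpleGraph.edge l v).edgeSet, IsStraightArc (E'.arc ⟨s(l, v), he⟩) := by
  classical
  obtain ⟨d, hd0, hfree⟩ := E.exists_free_segment v hv
  have hlK : ∀ e ∈ K.edgeSet, l ∉ e := by
    intro e he hle
    obtain ⟨w, rfl⟩ := Sym2.mem_iff_exists.1 hle
    exact hl w he
  have hnew : ∀ e ∈ (K ⊔ SimpleGraph.edge l v).edgeSet, e ∉ K.edgeSet → e = s(l, v) := by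
    intro e he hK
    rw [SimpleGraph.edgeSet_sup, SimpleGraph.edgeSet_edge_of_ne hlv] at he
    exact (he.resolve_left hK)
  -- `l` moves to `E.point v + d`; no other edge is affected because `l` was isolated.
  let new : C(unitInterval, EuclideanSpace ℝ (Fin 2)) :=
    ⟨fun t => E.point v + (t : ℝ) • d, by fun_prop⟩
  let pt := Function.update E.point l (E.point v + d)
  have hptl : pt l = E.point v + d := Function.update_self ..
  have hpt : ∀ w, w ≠ l → pt w = E.point w := fun w hw => Function.update_of_ne hw ..
  have hend : ∀ w, E.point w ≠ E.point v + d := fun w => by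
    simpa using (hfree 1 one_pos le_rfl).1 w
  have hnewval : ∀ t : unitInterval, new t = E.point v + (t : ℝ) • d := fun t => rfl
  let arc' : (K ⊔ SimpleGraph.edge l v).edgeSet → C(unitInterval, EuclideanSpace ℝ (Fin 2)) :=
    fun e => if h : e.1 ∈ K.edgeSet then E.arc ⟨e.1, h⟩ else new
  have harc_old : ∀ e : (K ⊔ SimpleGraph.edge l v).edgeSet, ∀ h : e.1 ∈ K.edgeSet,
      arc' e = E.arc ⟨e.1, h⟩ := fun e h => dif_pos h
  have harc_new : ∀ e : (K ⊔ SimpleGraph.edge l v).edgeSet, e.1 ∉ K.edgeSet → arc' e = new :=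
    fun e h => dif_neg h
  have hvl : s(l, v) ∉ K.edgeSet := hl v
  refine ⟨{ point := pt
            point_injective := ?_
            arc := arc'
            arc_injective := ?_
            arc_ends := ?_
            arc_ne_point := ?_
            arc_ne_arc := ?_ }, ?_, ?_⟩
  · intro x y hxy
    by_cases hx : x = l <;> by_cases hy : y = l
    · rw [hx, hy]
    · rw [hx, hptl, hpt y hy] at hxy
      exact (hend y hxy.symm).elim
    · rw [hy, hptl, hpt x hx] at hxy
      exact (hend x hxy).elim
    · rw [hpt x hx, hpt y hy] at hxy
      exact E.point_injective hxy
  · intro e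
    by_cases h : e.1 ∈ K.edgeSet
    · rw [harc_old e h]; exact E.arc_injective _
    · rw [harc_new e h]
      intro s t hst
      rw [hnewval, hnewval, add_right_inj] at hst
      exact Subtype.ext (smul_left_injective ℝ hd0 hst)
  · intro e
    by_cases h : e.1 ∈ K.edgeSet
    · rw [harc_old e h, E.arc_ends]
      refine Sym2.map_congr fun w hw => (hpt w ?_).symm
      rintro rfl
      exact hlK _ h hw
    · rw [harc_new e h, hnew _ e.2 h, Sym2.map_mk, hptl, hpt v hlv.symm, hnewval, hnewval, Sym2.eq_swap]
      simp
  · intro e t ht w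
    by_cases h : e.1 ∈ K.edgeSet
    · rw [harc_old e h]
      by_cases hw : w = l
      · rw [hw, hptl]
        simpa using (hfree 1 one_pos le_rfl).2 ⟨e.1, h⟩ t
      · rw [hpt w hw]; exact E.arc_ne_point _ t ht w
    · rw [harc_new e h, hnewval]
      by_cases hw : w = l
      · rw [hw, hptl]
        intro h
        rw [add_right_inj] at h
        have := smul_left_injective ℝ hd0 (h.trans (one_smul ℝ d).symm)
        exact ht.2.ne (Subtype.ext this)
      · rw [hpt w hw]
        exact ((hfree t ht.1 ht.2.le).1 w).symm
  · intro e f hef s hs t ht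
    by_cases he : e.1 ∈ K.edgeSet <;> by_cases hf : f.1 ∈ K.edgeSet
    · rw [harc_old e he, harc_old f hf]
      exact E.arc_ne_arc _ _ (fun h => hef (Subtype.ext (by simpa using h))) s hs t ht
    · rw [harc_old e he, harc_new f hf]
      exact (hfree t ht.1 ht.2.le).2 _ s
    · rw [harc_new e he, harc_old f hf]
      exact ((hfree s hs.1 hs.2.le).2 _ t).symm
    · exact (hef (Subtype.ext ((hnew _ e.2 he).trans (hnew _ f.2 hf).symm))).elim
  · intro e he he'
    exact harc_old ⟨e, he'⟩ he
  · intro he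
    change IsStraightArc (arc' _)
    rw [harc_new ⟨_, he⟩ hvl]
    intro t
    rw [hnewval, hnewval, hnewval, AffineMap.lineMap_apply_module]
    simp only [Set.Icc.coe_zero, Set.Icc.coe_one]
    module

end PlaneEmbedding

lemma SimpleGraph.IsAcyclic.exists_leaf {V : Type*} [Finite V] {F : SimpleGraph V}
    (hF : F.IsAcyclic) (hne : F ≠ ⊥) : ∃ l v, l ≠ v ∧ ∀ w, F.Adj l w ↔ w = v := by
  classical
  cases nonempty_fintype V
  obtain ⟨a, b, hab⟩ := SimpleGraph.ne_bot_iff_exists_adj.1 hne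
  let C := F.connectedComponentMk a
  have hT := hF.isTree_connectedComponent C
  have hbC : b ∈ C.supp := by
    simpa [C, SimpleGraph.ConnectedComponent.eq] using hab.symm.reachable
  have : Nontrivial C := ⟨⟨a, rfl⟩, ⟨b, hbC⟩, fun h => hab.ne (congrArg Subtype.val h)⟩
  obtain ⟨⟨l, hl⟩, hdeg⟩ := hT.exists_vert_degree_one_of_nontrivial
  obtain ⟨⟨v, hv⟩, hadj, huniq⟩ := SimpleGraph.degree_eq_one_iff_existsUnique_adj.1 hdeg
  have hadj' : F.Adj l v := hadj
  refine ⟨l, v, hadj'.ne, fun w => ⟨fun h => ?_, fun h => h ▸ hadj'⟩⟩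
  have hw : w ∈ C.supp := by
    have : F.connectedComponentMk w = F.connectedComponentMk l :=
      SimpleGraph.ConnectedComponent.sound h.symm.reachable
    exact this.trans hl
  exact congrArg Subtype.val (huniq ⟨w, hw⟩ h)

/-- A forest `F` can be added with straight edges to a drawing of `G` if no vertex has edges in both
graphs; induction on the number of edges of `F`, removing the edge at a leaf. -/
theorem PlaneEmbedding.exists_sup_forest {V : Type*} [Finite V] {G : SimpleGraph V}
    (E : PlaneEmbedding G) (k : ℕ) : ∀ F : SimpleGraph V, F.edgeSet.ncard = k → F.IsAcyclic →
    (∀ u w x, G.Adj u w → ¬ F.Adj u x) →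
    ∃ E' : PlaneEmbedding (G ⊔ F), ∀ e ∈ F.edgeSet, ∀ he' : e ∈ (G ⊔ F).edgeSet,
      IsStraightArc (E'.arc ⟨e, he'⟩) := by
  induction k with
  | zero =>
    intro F hk _ _
    have : F = ⊥ := by
      rw [← SimpleGraph.edgeSet_eq_empty]
      exact (Set.ncard_eq_zero (Set.toFinite _)).1 hk
    subst this
    rw [sup_bot_eq]
    exact ⟨E, fun e he => by simp at he⟩
  | succ k ih =>
    intro F hk hF hdisj
    have hne : F ≠ ⊥ := by
      rintro rfl
      simp at hk
    obtain ⟨l, v, hlv, hl⟩ := hF.exists_leaf hne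
    have hFlv : F.Adj l v := (hl v).2 rfl
    let F' := F.deleteEdges {s(l, v)}
    have hF'le : F' ≤ F := F.deleteEdges_le _
    have hk' : F'.edgeSet.ncard = k := by
      rw [SimpleGraph.edgeSet_deleteEdges, Set.ncard_sdiff_singleton_of_mem (F.mem_edgeSet.2 hFlv), hk]; rfl
    obtain ⟨E₁, hE₁⟩ := ih F' hk' (hF.anti hF'le) fun u w x h h' => hdisj u w x h (hF'le h')
    have hiso : ∀ w, ¬ (G ⊔ F').Adj l w := by
      intro w h
      rcases h with h | h
      · exact hdisj l w v h hFlv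
      · rw [SimpleGraph.deleteEdges_adj] at h
        exact h.2 (by rw [(hl w).1 h.1]; rfl)
    have hst : ∀ e : (G ⊔ F').edgeSet, v ∈ e.1 → IsStraightArc (E₁.arc e) := by
      rintro ⟨e, he⟩ hve
      obtain ⟨w, rfl⟩ := Sym2.mem_iff_exists.1 hve
      rcases he with h | h
      · exact (hdisj v w l h hFlv.symm).elim
      · exact hE₁ _ h _
    obtain ⟨E₂, hE₂, hE₂'⟩ := E₁.exists_sup_edge hlv hiso hst
    have heq : (G ⊔ F') ⊔ SimpleGraph.edge l v = G ⊔ F := by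
      rw [sup_assoc]
      congr 1
      ext x y
      simp only [F', SimpleGraph.sup_adj, SimpleGraph.deleteEdges_adj, SimpleGraph.adj_edge,
        Set.mem_singleton_iff]
      constructor
      · rintro (h | ⟨h, -⟩)
        · exact h.1
        · rw [← SimpleGraph.mem_edgeSet, ← h]; exact hFlv
      · intro h
        by_cases h' : s(x, y) = s(l, v)
        · exact Or.inr ⟨h'.symm, h.ne⟩
        · exact Or.inl ⟨h, h'⟩
    rw [← heq]
    refine ⟨E₂, fun e he he' => ?_⟩
    by_cases h : e = s(l, v)
    · subst h
      exact hE₂' he'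
    · have heF' : e ∈ F'.edgeSet := by
        rw [SimpleGraph.edgeSet_deleteEdges]; exact ⟨he, h⟩
      have h1 : e ∈ (G ⊔ F').edgeSet := by
        rw [SimpleGraph.edgeSet_sup]; exact Or.inr heF'
      rw [hE₂ e h1 he']
      exact hE₁ e heF' h1

/-- The connected component of `a` in `G` is a tree: no cycle of `G` passes through a vertex that is
reachable from `a`. -/
def SimpleGraph.InTree {V : Type*} (G : SimpleGraph V) (a : V) : Prop :=
  ∀ u, G.Reachable a u → ∀ c : G.Walk u u, ¬ c.IsCycle

/-- Joining two tree components by an edge preserves planarity: their union with the new edge is a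
forest, which is drawn afresh next to the other components. -/
theorem IsPlanarGraph.sup_edge {V : Type*} [Finite V] {G : SimpleGraph V} (h : IsPlanarGraph G)
    {a b : V} (hab : ¬ G.Reachable a b) (ha : G.InTree a) (hb : G.InTree b) :
    IsPlanarGraph (G ⊔ SimpleGraph.edge a b) := by
  let S : Set V := {u | G.Reachable a u ∨ G.Reachable b u}
  have hS : ∀ u w, G.Adj u w → (u ∈ S ↔ w ∈ S) := fun u w h =>
    or_congr ⟨fun k => k.trans h.reachable, fun k => k.trans h.symm.reachable⟩
      ⟨fun k => k.trans h.reachable, fun k => k.trans h.symm.reachable⟩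
  let F : SimpleGraph V :=
    { Adj := fun u w => G.Adj u w ∧ u ∈ S
      symm := ⟨fun u w h => ⟨h.1.symm, (hS u w h.1).1 h.2⟩⟩
      loopless := ⟨fun u h => h.1.ne rfl⟩ }
  let G₀ : SimpleGraph V :=
    { Adj := fun u w => G.Adj u w ∧ u ∉ S
      symm := ⟨fun u w h => ⟨h.1.symm, fun k => h.2 ((hS u w h.1).2 k)⟩⟩
      loopless := ⟨fun u h => h.1.ne rfl⟩ }
  have hFle : F ≤ G := fun u w h => h.1
  have hG₀le : G₀ ≤ G := fun u w h => h.1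
  have hF : F.IsAcyclic := by
    intro u c hc
    have hu : u ∈ S := by
      cases c with
      | nil => exact (hc.ne_nil rfl).elim
      | cons h p => exact h.2
    rcases hu with hu | hu
    · exact ha u hu (c.mapLe hFle) (hc.mapLe hFle)
    · exact hb u hu (c.mapLe hFle) (hc.mapLe hFle)
  have hF' : (F ⊔ SimpleGraph.edge a b).IsAcyclic :=
    hF.sup_edge_of_not_reachable fun k => hab (k.mono hFle)
  obtain ⟨E⟩ := h.mono hG₀le
  obtain ⟨E', -⟩ := E.exists_sup_forest _ _ rfl hF' (by
    rintro u w x h (h' | h')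
    · exact h.2 h'.2
    · rw [SimpleGraph.edge_adj] at h'
      rcases h'.1 with ⟨rfl, -⟩ | ⟨rfl, -⟩
      · exact h.2 (Or.inl (SimpleGraph.Reachable.refl _))
      · exact h.2 (Or.inr (SimpleGraph.Reachable.refl _)))
  have heq : G₀ ⊔ (F ⊔ SimpleGraph.edge a b) = G ⊔ SimpleGraph.edge a b := by
    rw [← sup_assoc]
    congr 1
    ext u w
    change (G.Adj u w ∧ u ∉ S) ∨ (G.Adj u w ∧ u ∈ S) ↔ _
    by_cases hu : u ∈ S <;> simp [hu]
  exact ⟨heq ▸ E'⟩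

/-! ### Edge swaps -/

namespace SimpleGraph

variable {V W : Type*}

/-- The graph obtained from `G` by removing the edge `xy` and inserting the edge `ab`. -/
def edgeSwap (G : SimpleGraph V) (x y a b : V) : SimpleGraph V :=
  G.deleteEdges {s(x, y)} ⊔ edge a b

lemma edgeSwap_adj {G : SimpleGraph V} {x y a b u w : V} :
    (G.edgeSwap x y a b).Adj u w ↔
      (G.Adj u w ∧ s(u, w) ≠ s(x, y)) ∨ (s(a, b) = s(u, w) ∧ u ≠ w) := by
  simp [edgeSwap, adj_edge]

lemma edgeSwap_adj_of_notMem {G : SimpleGraph V} {x y a b u : V}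
    (hu : u ≠ x ∧ u ≠ y ∧ u ≠ a ∧ u ≠ b) (w : V) :
    (G.edgeSwap x y a b).Adj u w ↔ G.Adj u w := by
  rw [edgeSwap_adj, Ne, Sym2.eq_iff, Sym2.eq_iff]
  grind

lemma edgeSet_edgeSwap {G : SimpleGraph V} {x y a b : V} (hab : a ≠ b) :
    (G.edgeSwap x y a b).edgeSet = insert s(a, b) (G.edgeSet \ {s(x, y)}) := by
  rw [edgeSwap, edgeSet_sup, edgeSet_deleteEdges, edgeSet_edge_of_ne hab, union_comm]
  rfl

lemma ncard_edgeSet_edgeSwap [Finite V] {G : SimpleGraph V} {x y a b : V} (hxy : G.Adj x y)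
    (hab : a ≠ b) (hnab : ¬ G.Adj a b) :
    (G.edgeSwap x y a b).edgeSet.ncard = G.edgeSet.ncard := by
  rw [edgeSet_edgeSwap hab, Set.ncard_insert_of_notMem (fun h => hnab h.1),
    Set.ncard_sdiff_singleton_add_one (G.mem_edgeSet.2 hxy)]

lemma eq_of_edgeSwap_eq {G₁ G₂ : SimpleGraph V} {x y a b : V} (hab : a ≠ b)
    (h₁ : G₁.Adj x y) (h₂ : G₂.Adj x y) (h₁' : ¬ G₁.Adj a b) (h₂' : ¬ G₂.Adj a b)
    (h : G₁.edgeSwap x y a b = G₂.edgeSwap x y a b) : G₁ = G₂ := by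
  have key : ∀ G : SimpleGraph V, G.Adj x y → ¬ G.Adj a b →
      G.edgeSet = insert s(x, y) ((G.edgeSwap x y a b).edgeSet \ {s(a, b)}) := by
    intro G hxy hnab
    have h1 : s(a, b) ∉ G.edgeSet \ {s(x, y)} := fun h => hnab h.1
    rw [edgeSet_edgeSwap hab, insert_sdiff_of_mem _ (mem_singleton _), sdiff_singleton_eq_self h1,
      insert_sdiff_singleton, insert_eq_of_mem (G.mem_edgeSet.2 hxy)]
  rw [← edgeSet_inj, key G₁ h₁ h₁', key G₂ h₂ h₂', h]

/-- The set `S` may be larger than the component of `a`. -/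
lemma inTree_of_isAcyclic_induce {G : SimpleGraph V} {a : V} {S : Set V}
    (hS : ∀ u, G.Reachable a u → u ∈ S) (hG : (G.induce S).IsAcyclic) : G.InTree a := by
  classical
  intro u hu c hc
  have hsupp : ∀ w ∈ c.support, w ∈ S := fun w hw =>
    hS w (hu.trans (c.takeUntil w hw).reachable)
  refine hG (c.induce S hsupp) ?_
  refine Walk.IsCycle.of_map (f := (Embedding.induce S).toHom) ?_
  rw [Walk.map_induce]
  exact hc

/-! ### Tree components -/

/-- A graph has at least `|V| - |E|` tree components, here given by one vertex `a ∈ R` of each: every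
component that is not a tree has at least as many edges as vertices. -/
theorem exists_tree_representatives [Fintype V] (G : SimpleGraph V) :
    ∃ R : Finset V, Fintype.card V ≤ G.edgeSet.ncard + R.card ∧ (∀ a ∈ R, G.InTree a) ∧
      ∀ a ∈ R, ∀ b ∈ R, a ≠ b → ¬ G.Reachable a b := by
  classical
  let T : Finset G.ConnectedComponent := Finset.univ.filter fun C => C.toSimpleGraph.IsTree
  choose rep hrep using fun C : G.ConnectedComponent => C.exists_rep
  replace hrep : ∀ C, G.connectedComponentMk (rep C) = C := hrep
  have hinj : Function.Injective rep := Function.LeftInverse.injective hrep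
  refine ⟨T.image rep, ?_, ?_, ?_⟩
  · rw [Finset.card_image_of_injective _ hinj]
    have h1 : Fintype.card V = ∑ C : G.ConnectedComponent, Nat.card C := by
      rw [← Nat.card_eq_fintype_card,
        ← Nat.card_congr (Equiv.sigmaFiberEquiv G.connectedComponentMk), Nat.card_sigma]
      rfl
    have h2 : ∀ C : G.ConnectedComponent,
        Nat.card C ≤ Nat.card C.toSimpleGraph.edgeSet + if C.toSimpleGraph.IsTree then 1 else 0 := by
      intro C
      have hc := C.connected_toSimpleGraph
      have h3 := hc.card_vert_le_card_edgeSet_add_one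
      split_ifs with h
      · exact h3
      · rw [isTree_iff_connected_and_card] at h
        exact Nat.le_of_lt_succ (lt_of_le_of_ne h3 fun k => h ⟨hc, k.symm⟩)
    have h4 : ∑ C : G.ConnectedComponent, Nat.card C.toSimpleGraph.edgeSet ≤ G.edgeSet.ncard := by
      rw [← Nat.card_sigma, ← Nat.card_coe_set_eq]
      let f : (Σ C : G.ConnectedComponent, C.toSimpleGraph.edgeSet) → G.edgeSet := fun p =>
        ⟨Sym2.map Subtype.val p.2.1, by
          obtain ⟨C, ⟨e, he⟩⟩ := p
          induction e with | _ u w => exact he⟩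
      refine Nat.card_le_card_of_injective f ?_
      rintro ⟨C, ⟨e, he⟩⟩ ⟨C', ⟨e', he'⟩⟩ h
      have h' : Sym2.map Subtype.val e = Sym2.map Subtype.val e' := congrArg Subtype.val h
      have hC : C = C' := by
        induction e with | _ u w =>
        induction e' with | _ u' w' =>
        have hu : u.1 ∈ Sym2.map Subtype.val s(u', w') := by rw [← h']; simp
        obtain ⟨z, -, hz⟩ := Sym2.mem_map.1 hu
        have h5 : G.connectedComponentMk u.1 = C := u.2
        have h6 : G.connectedComponentMk z.1 = C' := z.2
        rw [← h5, ← h6, hz]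
      subst hC
      have := Sym2.map.injective Subtype.val_injective h'
      subst this
      rfl
    calc Fintype.card V = ∑ C : G.ConnectedComponent, Nat.card C := h1
      _ ≤ ∑ C : G.ConnectedComponent, (Nat.card C.toSimpleGraph.edgeSet +
          if C.toSimpleGraph.IsTree then 1 else 0) := Finset.sum_le_sum fun C _ => h2 C
      _ ≤ G.edgeSet.ncard + T.card := by
        rw [Finset.sum_add_distrib, ← Finset.card_filter]
        exact Nat.add_le_add_right h4 _
  · intro a ha
    obtain ⟨C, hC, rfl⟩ := Finset.mem_image.1 ha
    refine inTree_of_isAcyclic_induce (S := C.supp) (fun u hu => ?_) (Finset.mem_filter.1 hC).2.2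
    have : G.connectedComponentMk u = G.connectedComponentMk (rep C) :=
      ConnectedComponent.sound hu.symm
    exact this.trans (hrep C)
  · intro a ha b hb hab h
    obtain ⟨C, hC, rfl⟩ := Finset.mem_image.1 ha
    obtain ⟨C', hC', rfl⟩ := Finset.mem_image.1 hb
    have : C = C' := by
      rw [← hrep C, ← hrep C']
      exact ConnectedComponent.sound h
    exact hab (this ▸ rfl)

/-! ### Components isomorphic to a given graph -/

/-- The map `φ` identifies `H` with a union of connected components of `G`: it is injective, and the
neighbours of `φ x` in `G` are exactly the images of the neighbours of `x`. If `H` is connected, the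
image is a single component. -/
structure IsComponentCopy (H : SimpleGraph W) (G : SimpleGraph V) (φ : W → V) : Prop where
  injective : Function.Injective φ
  adj_iff : ∀ x v, G.Adj (φ x) v ↔ ∃ y, H.Adj x y ∧ φ y = v

namespace IsComponentCopy

variable {H : SimpleGraph W} {G G' : SimpleGraph V} {φ : W → V}

lemma map_adj_iff (h : IsComponentCopy H G φ) {x y : W} : G.Adj (φ x) (φ y) ↔ H.Adj x y := by
  rw [h.adj_iff]
  constructor
  · rintro ⟨z, hz, hzy⟩
    exact h.injective hzy ▸ hz
  · exact fun k => ⟨y, k, rfl⟩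

lemma mem_range_of_reachable (h : IsComponentCopy H G φ) {u v : V} (hu : u ∈ range φ)
    (huv : G.Reachable u v) : v ∈ range φ := by
  obtain ⟨p⟩ := huv
  induction p with
  | nil => exact hu
  | cons hadj p ih =>
    obtain ⟨x, rfl⟩ := hu
    obtain ⟨y, -, rfl⟩ := (h.adj_iff _ _).1 hadj
    exact ih ⟨y, rfl⟩

lemma reachable_iff (h : IsComponentCopy H G φ) (hH : H.Preconnected) {x : W} {v : V} :
    G.Reachable (φ x) v ↔ v ∈ range φ := by
  refine ⟨h.mem_range_of_reachable ⟨x, rfl⟩, ?_⟩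
  rintro ⟨y, rfl⟩
  exact (hH x y).map (⟨φ, fun k => h.map_adj_iff.2 k⟩ : H →g G)

lemma inTree (h : IsComponentCopy H G φ) (hH : H.IsAcyclic) (x : W) : G.InTree (φ x) := by
  refine inTree_of_isAcyclic_induce (S := range φ)
    (fun u hu => h.mem_range_of_reachable ⟨x, rfl⟩ hu) ?_
  let f : G.induce (range φ) →g H :=
    ⟨fun s => s.2.choose, fun {s t} hst => by
      have hst' : G.Adj s.1 t.1 := hst
      rw [← s.2.choose_spec, ← t.2.choose_spec, h.map_adj_iff] at hst'
      exact hst'⟩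
  refine hH.comap f fun s t hst => Subtype.ext ?_
  have hst' : s.2.choose = t.2.choose := hst
  rw [← s.2.choose_spec, ← t.2.choose_spec, hst']

lemma congr (h : IsComponentCopy H G φ) {Z : Set V}
    (hZ : ∀ u ∉ Z, ∀ w, G'.Adj u w ↔ G.Adj u w) (hφ : ∀ x, φ x ∉ Z) : IsComponentCopy H G' φ :=
  ⟨h.injective, fun x v => (hZ _ (hφ x) v).trans (h.adj_iff x v)⟩

/-- Hanging an isolated vertex `v` of `G` on a copy of `H - l`, at the vertex `a` that stands for
the neighbour of the leaf `l`, turns it into a copy of `H`; the deleted edge lies elsewhere. -/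
theorem exists_edgeSwap {l r : W} (hl : ∀ w, H.Adj l w ↔ w = r) (hr : r ∈ ({l}ᶜ : Set W))
    {ψ : ({l}ᶜ : Set W) → V} (h : IsComponentCopy (H.induce {l}ᶜ) G ψ) {v x y : V}
    (hv : ∀ w, ¬ G.Adj v w) (hvψ : v ∉ range ψ) (hxy : G.Adj x y) (hx : x ∉ range ψ) :
    ∃ φ : W → V, IsComponentCopy H (G.edgeSwap x y (ψ ⟨r, hr⟩) v) φ ∧ φ l = v := by
  classical
  let φ : W → V := fun w => if hw : w = l then v else ψ ⟨w, hw⟩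
  have hφl : φ l = v := dif_pos rfl
  have hφ : ∀ w (hw : w ≠ l), φ w = ψ ⟨w, hw⟩ := fun w hw => dif_neg hw
  have hy : y ∉ range ψ := fun k => hx (h.mem_range_of_reachable k hxy.symm.reachable)
  have hvx : v ≠ x := by rintro rfl; exact hv _ hxy
  have hvy : v ≠ y := by rintro rfl; exact hv _ hxy.symm
  have hψv : ∀ w, ψ w ≠ v := fun w k => hvψ ⟨w, k⟩
  have hψx : ∀ w, ψ w ≠ x := fun w k => hx ⟨w, k⟩
  have hψy : ∀ w, ψ w ≠ y := fun w k => hy ⟨w, k⟩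
  have hadjv : ∀ w, (G.edgeSwap x y (ψ ⟨r, hr⟩) v).Adj v w ↔ w = ψ ⟨r, hr⟩ := by
    intro w
    rw [edgeSwap_adj, Sym2.eq_iff]
    have := hv w
    have := hψv ⟨r, hr⟩
    grind
  have hadjψ : ∀ z w, (G.edgeSwap x y (ψ ⟨r, hr⟩) v).Adj (ψ z) w ↔
      G.Adj (ψ z) w ∨ (z = ⟨r, hr⟩ ∧ w = v) := by
    intro z w
    rw [edgeSwap_adj, Ne, Sym2.eq_iff, Sym2.eq_iff]
    have := hψv z
    have := hψx z
    have := hψy z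
    have := @h.injective z ⟨r, hr⟩
    grind
  refine ⟨φ, ⟨?_, ?_⟩, hφl⟩
  · intro s t hst
    by_cases hs : s = l <;> by_cases ht : t = l
    · rw [hs, ht]
    · rw [hs, hφl, hφ t ht] at hst
      exact (hψv _ hst.symm).elim
    · rw [ht, hφl, hφ s hs] at hst
      exact (hψv _ hst).elim
    · rw [hφ s hs, hφ t ht] at hst
      exact congrArg Subtype.val (h.injective hst)
  · intro s w
    by_cases hs : s = l
    · subst hs
      rw [hφl, hadjv]
      simp only [hl, exists_eq_left]
      rw [hφ r hr, eq_comm]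
    · rw [hφ s hs, hadjψ, h.adj_iff]
      constructor
      · rintro (⟨t, ht, rfl⟩ | ⟨hz, rfl⟩)
        · exact ⟨t.1, ht, hφ t.1 t.2⟩
        · have : s = r := congrArg Subtype.val hz
          exact ⟨l, this ▸ ((hl r).2 rfl).symm, hφl⟩
      · rintro ⟨t, ht, rfl⟩
        by_cases htl : t = l
        · subst htl
          right
          exact ⟨Subtype.ext ((hl s).1 ht.symm), hφl⟩
        · left
          exact ⟨⟨t, htl⟩, ht, (hφ t htl).symm⟩

end IsComponentCopy

/-- The vertices of `G` that play the role of the vertex `r` of `H` in a component of `G` isomorphic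
to the connected graph `H`. -/
def rootedCopies (H : SimpleGraph W) (r : W) (G : SimpleGraph V) : Set V :=
  {a | ∃ φ : W → V, IsComponentCopy H G φ ∧ φ r = a}

/-- Altering the adjacencies at the vertices of `Z` only affects the copies that meet `Z`, and a
vertex of `Z` lies in at most one copy, which has `|W|` vertices. -/
theorem ncard_rootedCopies_le [Finite V] [Finite W] {H : SimpleGraph W} (hH : H.Preconnected)
    (r : W) {G G' : SimpleGraph V} (Z : Finset V)
    (hZ : ∀ u ∉ Z, ∀ w, G'.Adj u w ↔ G.Adj u w) :
    (rootedCopies H r G).ncard ≤ (rootedCopies H r G').ncard + Z.card * Nat.card W := by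
  classical
  let D : V → Set V := fun z => {a | a ∈ rootedCopies H r G ∧ G.Reachable a z}
  have hD : ∀ z, (D z).ncard ≤ Nat.card W := by
    intro z
    rcases (D z).eq_empty_or_nonempty with h | ⟨a, ⟨φ, hφ, rfl⟩, haz⟩
    · simp [h]
    · have hsub : D z ⊆ range φ := fun b hb =>
        hφ.mem_range_of_reachable ⟨r, rfl⟩ (haz.trans hb.2.symm)
      calc (D z).ncard ≤ (range φ).ncard := Set.ncard_le_ncard hsub (toFinite _)
        _ ≤ Nat.card W := by
          rw [← image_univ, ← Set.ncard_univ]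
          exact Set.ncard_image_le (toFinite _)
  have hsub : rootedCopies H r G ⊆ rootedCopies H r G' ∪ ⋃ z ∈ Z, D z := by
    rintro a ⟨φ, hφ, rfl⟩
    by_cases h : ∀ x, φ x ∉ (Z : Set V)
    · exact Or.inl ⟨φ, hφ.congr hZ h, rfl⟩
    · push Not at h
      obtain ⟨x, hx⟩ := h
      right
      simp only [mem_iUnion]
      exact ⟨φ x, hx, ⟨φ, hφ, rfl⟩, (hφ.reachable_iff hH).2 ⟨x, rfl⟩⟩
  calc (rootedCopies H r G).ncard ≤ (rootedCopies H r G' ∪ ⋃ z ∈ Z, D z).ncard :=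
        Set.ncard_le_ncard hsub (toFinite _)
    _ ≤ (rootedCopies H r G').ncard + (⋃ z ∈ Z, D z).ncard := Set.ncard_union_le _ _
    _ ≤ (rootedCopies H r G').ncard + ∑ z ∈ Z, (D z).ncard :=
        Nat.add_le_add_left (Finset.set_ncard_biUnion_le _ _) _
    _ ≤ (rootedCopies H r G').ncard + Z.card * Nat.card W := by
        gcongr
        rw [← smul_eq_mul]
        exact Finset.sum_le_card_nsmul _ _ _ fun z _ => hD z

theorem ncard_rootedCopies_le_isoComponentCount [Finite V] [Finite W] {H : SimpleGraph W}
    (hH : H.Preconnected) (r : W) (G : SimpleGraph V) :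
    (rootedCopies H r G).ncard ≤ isoComponentCount H G * Nat.card W := by
  classical
  let 𝒞 : Set G.ConnectedComponent := {C | Nonempty (C.toSimpleGraph ≃g H)}
  have hfin : 𝒞.Finite := toFinite _
  have hsub : rootedCopies H r G ⊆ ⋃ C ∈ hfin.toFinset, C.supp := by
    rintro a ⟨φ, hφ, rfl⟩
    simp only [mem_iUnion, Set.Finite.mem_toFinset]
    refine ⟨G.connectedComponentMk (φ r), ?_, rfl⟩
    have hsupp : ∀ v, v ∈ (G.connectedComponentMk (φ r)).supp ↔ v ∈ range φ := fun v => by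
      rw [← hφ.reachable_iff hH (x := r), ConnectedComponent.mem_supp_iff, ConnectedComponent.eq]
      exact ⟨fun h => h.symm, fun h => h.symm⟩
    let e : W ≃ (G.connectedComponentMk (φ r)).supp :=
      Equiv.ofBijective (fun w => ⟨φ w, (hsupp _).2 ⟨w, rfl⟩⟩)
        ⟨fun s t h => hφ.injective (congrArg Subtype.val h), fun v => by
          obtain ⟨w, hw⟩ := (hsupp _).1 v.2
          exact ⟨w, Subtype.ext hw⟩⟩
    let i : H ≃g (G.connectedComponentMk (φ r)).toSimpleGraph := ⟨e, hφ.map_adj_iff⟩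
    exact ⟨i.symm⟩
  calc (rootedCopies H r G).ncard ≤ (⋃ C ∈ hfin.toFinset, C.supp).ncard :=
        Set.ncard_le_ncard hsub (toFinite _)
    _ ≤ ∑ C ∈ hfin.toFinset, C.supp.ncard := Finset.set_ncard_biUnion_le _ _
    _ ≤ hfin.toFinset.card * Nat.card W := by
        rw [← smul_eq_mul]
        refine Finset.sum_le_card_nsmul _ _ _ fun C hC => ?_
        obtain ⟨i⟩ := (Set.Finite.mem_toFinset _).1 hC
        rw [← Nat.card_congr i.toEquiv]
        rfl
    _ = isoComponentCount H G * Nat.card W := by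
        rw [← Set.ncard_eq_toFinset_card _ hfin]; rfl

lemma isoComponentCount_le_ncard_rootedCopies [Finite V] (H : SimpleGraph W) (r : W)
    (G : SimpleGraph V) : isoComponentCount H G ≤ (rootedCopies H r G).ncard := by
  have key : ∀ C ∈ {C : G.ConnectedComponent | Nonempty (C.toSimpleGraph ≃g H)},
      ∃ a ∈ rootedCopies H r G, G.connectedComponentMk a = C := by
    rintro C ⟨i⟩
    refine ⟨(i.symm r).1, ⟨fun w => (i.symm w).1, ⟨?_, ?_⟩, rfl⟩, (i.symm r).2⟩
    · exact Subtype.val_injective.comp i.symm.injective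
    · intro x v
      constructor
      · intro hadj
        have hv : v ∈ C.supp := by
          have h1 : G.connectedComponentMk v = G.connectedComponentMk (i.symm x).1 :=
            ConnectedComponent.sound hadj.symm.reachable
          exact h1.trans (i.symm x).2
        refine ⟨i ⟨v, hv⟩, ?_, by simp⟩
        rw [← i.symm.map_adj_iff, RelIso.symm_apply_apply]
        exact hadj
      · rintro ⟨y, hy, rfl⟩
        exact i.symm.map_adj_iff.2 hy
  rcases isEmpty_or_nonempty V with hV | hV
  · have : IsEmpty G.ConnectedComponent := ⟨fun C => C.exists_rep.elim fun v _ => hV.elim v⟩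
    simp [isoComponentCount, Set.eq_empty_of_isEmpty]
  choose! f hf hf' using key
  refine Set.ncard_le_ncard_of_injOn f hf (fun C hC C' hC' h => ?_) (toFinite _)
  rw [← hf' C hC, ← hf' C' hC', h]

end SimpleGraph

/-! ### Swaps of planar graphs -/

theorem edgeSwap_mem_planarGraphs {n m : ℕ} {G : SimpleGraph (Fin n)} (hG : G ∈ planarGraphs n m)
    {x y a b : Fin n} (hxy : G.Adj x y) (hab : ¬ G.Reachable a b) (ha : G.InTree a)
    (hb : G.InTree b) : G.edgeSwap x y a b ∈ planarGraphs n m := by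
  have hne : a ≠ b := fun h => hab (h ▸ Reachable.refl _)
  refine ⟨(hG.1.sup_edge hab ha hb).mono (sup_le_sup_right (G.deleteEdges_le _) _), ?_⟩
  rw [ncard_edgeSet_edgeSwap hxy hne fun h => hab h.reachable, hG.2]

theorem planarGraphs_nonempty {n m : ℕ} (h : m < n) : (planarGraphs n m).Nonempty := by
  induction m with
  | zero => exact ⟨⊥, isPlanarGraph_bot_fin n, by simp⟩
  | succ m ih =>
    obtain ⟨G, hG, hm⟩ := ih (by omega)
    obtain ⟨R, hR, hT, hR'⟩ := G.exists_tree_representatives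
    rw [Fintype.card_fin, hm] at hR
    obtain ⟨a, ha, b, hb, hab⟩ := Finset.one_lt_card.1 (show 1 < R.card by omega)
    have hr := hR' a ha b hb hab
    refine ⟨G ⊔ edge a b, hG.sup_edge hr (hT a ha) (hT b hb), ?_⟩
    rw [edgeSet_sup, edgeSet_edge_of_ne hab, union_singleton,
      Set.ncard_insert_of_notMem fun h => hr (G.mem_edgeSet.1 h).reachable, hm]

namespace SimpleGraph

variable {V W : Type*}

/-! ### Isolated vertices and leaves -/

/-- The vertices without neighbours. -/
def isolatedVertices (G : SimpleGraph V) : Set V := {v | ∀ w, ¬ G.Adj v w}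

/-- The vertices with exactly one neighbour. -/
def leaves (G : SimpleGraph V) : Set V := {v | ∃ u, ∀ w, G.Adj v w ↔ w = u}

lemma ncard_isolatedVertices_le [Finite V] {G G' : SimpleGraph V} (Z : Finset V)
    (hZ : ∀ u ∉ Z, ∀ w, G.Adj u w → G'.Adj u w) :
    G'.isolatedVertices.ncard ≤ G.isolatedVertices.ncard + Z.card := by
  have hsub : G'.isolatedVertices ⊆ G.isolatedVertices ∪ Z := by
    intro v hv
    by_cases h : v ∈ Z
    · exact Or.inr h
    · exact Or.inl fun w hw => hv w (hZ v h w hw)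
  calc G'.isolatedVertices.ncard ≤ (G.isolatedVertices ∪ Z).ncard :=
        Set.ncard_le_ncard hsub (toFinite _)
    _ ≤ G.isolatedVertices.ncard + (Z : Set V).ncard := Set.ncard_union_le _ _
    _ = _ := by rw [Set.ncard_coe_finset]

lemma ncard_adj_eq [Finite V] (G : SimpleGraph V) :
    {p : V × V | G.Adj p.1 p.2}.ncard = 2 * G.edgeSet.ncard := by
  classical
  cases nonempty_fintype V
  rw [Set.ncard_eq_toFinset_card', Set.ncard_eq_toFinset_card', Set.toFinset_ofPred]
  exact G.two_mul_card_edgeFinset.symm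

/-- A vertex has degree at least two unless it is a leaf or isolated; sum over all vertices. -/
lemma two_mul_card_le_leaves [Fintype V] (G : SimpleGraph V) :
    2 * Fintype.card V ≤
      2 * G.edgeSet.ncard + 2 * G.isolatedVertices.ncard + G.leaves.ncard := by
  classical
  have hdeg : ∀ v, 2 ≤ G.degree v + 2 * (if v ∈ G.isolatedVertices then 1 else 0) +
      if v ∈ G.leaves then 1 else 0 := by
    intro v
    by_cases h0 : G.degree v = 0
    · have : v ∈ G.isolatedVertices := fun w hw =>
        ((G.degree_pos_iff_exists_adj v).2 ⟨w, hw⟩).ne' h0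
      rw [if_pos this]
      omega
    · by_cases h1 : G.degree v = 1
      · obtain ⟨u, hu, huniq⟩ := degree_eq_one_iff_existsUnique_adj.1 h1
        have : v ∈ G.leaves := ⟨u, fun w => ⟨huniq w, fun h => h ▸ hu⟩⟩
        rw [if_pos this]
        omega
      · omega
  have hsum := Finset.sum_le_sum fun v (_ : v ∈ Finset.univ) => hdeg v
  rw [Finset.sum_add_distrib, Finset.sum_add_distrib, ← Finset.mul_sum, ← Finset.card_filter,
    ← Finset.card_filter, G.sum_degrees_eq_twice_card_edges, Finset.sum_const, smul_eq_mul,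
    Finset.card_univ] at hsum
  have e1 : G.edgeSet.ncard = G.edgeFinset.card := Set.ncard_eq_toFinset_card' _
  have e2 : ∀ S : Set V, S.ncard = (Finset.univ.filter (· ∈ S)).card := fun S => by
    rw [Set.ncard_eq_toFinset_card']
    congr 1
    ext
    simp
  rw [e1, e2, e2]
  omega

end SimpleGraph

/-! ### Double counting of swaps -/

/-- Double counting of edge swaps `(G, (x, y, a, b)) ↦ G.edgeSwap x y a b` from `X` to `Y`. A swap
is determined by its result and the four vertices, so that it is enough to bound the number of
possible quadruples below at every graph of `X` and above at every graph of `Y`. -/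
theorem ncard_mul_le_of_edgeSwap {V : Type*} [Finite V] {X Y : Set (SimpleGraph V)}
    (M B : SimpleGraph V → Set (V × V × V × V)) {f b : ℕ}
    (hM : ∀ G ∈ X, ∀ q ∈ M G, G.Adj q.1 q.2.1 ∧ q.2.2.1 ≠ q.2.2.2 ∧ ¬ G.Adj q.2.2.1 q.2.2.2 ∧
      G.edgeSwap q.1 q.2.1 q.2.2.1 q.2.2.2 ∈ Y ∧
      q ∈ B (G.edgeSwap q.1 q.2.1 q.2.2.1 q.2.2.2))
    (hf : ∀ G ∈ X, f ≤ (M G).ncard) (hb : ∀ G ∈ Y, (B G).ncard ≤ b) :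
    X.ncard * f ≤ Y.ncard * b := by
  classical
  cases nonempty_fintype V
  have hcard : ∀ (S : Set (SimpleGraph V)) (N : SimpleGraph V → Set (V × V × V × V)),
      (S.toFinset.sigma fun G => (N G).toFinset).card = ∑ G ∈ S.toFinset, (N G).ncard := by
    intro S N
    rw [Finset.card_sigma]
    exact Finset.sum_congr rfl fun G _ => (Set.ncard_eq_toFinset_card' _).symm
  have hle : (X.toFinset.sigma fun G => (M G).toFinset).card ≤
      (Y.toFinset.sigma fun G => (B G).toFinset).card := by
    refine Finset.card_le_card_of_injOn
      (fun p => ⟨p.1.edgeSwap p.2.1 p.2.2.1 p.2.2.2.1 p.2.2.2.2, p.2⟩) ?_ ?_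
    · rintro ⟨G, q⟩ h
      simp only [Finset.coe_sigma, Set.mem_sigma_iff, Finset.mem_coe, Set.mem_toFinset] at h ⊢
      exact (hM G h.1 q h.2).2.2.2
    · rintro ⟨G₁, q₁⟩ h₁ ⟨G₂, q₂⟩ h₂ h
      simp only [Finset.coe_sigma, Set.mem_sigma_iff, Finset.mem_coe, Set.mem_toFinset] at h₁ h₂
      simp only [Sigma.mk.injEq, heq_eq_eq] at h
      obtain ⟨h, rfl⟩ := h
      have k₁ := hM G₁ h₁.1 q₁ h₁.2
      have k₂ := hM G₂ h₂.1 q₁ h₂.2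
      rw [eq_of_edgeSwap_eq k₁.2.1 k₁.1 k₂.1 k₁.2.2.1 k₂.2.2.1 h]
  rw [hcard, hcard] at hle
  calc X.ncard * f ≤ ∑ G ∈ X.toFinset, (M G).ncard := by
        rw [Set.ncard_eq_toFinset_card', ← smul_eq_mul]
        exact Finset.card_nsmul_le_sum _ _ _ fun G hG => hf G (Set.mem_toFinset.1 hG)
    _ ≤ ∑ G ∈ Y.toFinset, (B G).ncard := hle
    _ ≤ Y.ncard * b := by
        rw [Set.ncard_eq_toFinset_card', ← smul_eq_mul]
        exact Finset.sum_le_card_nsmul _ _ _ fun G hG => hb G (Set.mem_toFinset.1 hG)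

/-- Counts the swaps that cut off a leaf `v` from its neighbour `u` and join two tree components by an
edge `ab`. The quadruple `(v, u, a, b)` of a swap with result `G'` is such that `v` is isolated in
`G'` and `ab` is one of its `m` edges, in one of two directions. -/
theorem ncard_isolatedVertices_step (n m s : ℕ) :
    {G ∈ planarGraphs n m | G.isolatedVertices.ncard ≤ s}.ncard *
        ((2 * (n - m) - 2 * s) * ((n - m - 1) * (n - m - 2))) ≤
      {G ∈ planarGraphs n m | G.isolatedVertices.ncard ≤ s + 2}.ncard * ((s + 2) * (n * (2 * m))) := by
  classical
  choose R hRcard hRtree hRsep using fun G : SimpleGraph (Fin n) => G.exists_tree_representatives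
  refine ncard_mul_le_of_edgeSwap
    (fun G => {q | (∀ w, G.Adj q.1 w ↔ w = q.2.1) ∧ (q.2.2.1 ∈ R G ∧ q.2.2.1 ≠ q.1) ∧
      (q.2.2.2 ∈ R G ∧ q.2.2.2 ≠ q.1) ∧ q.2.2.1 ≠ q.2.2.2})
    (fun G => G.isolatedVertices ×ˢ (univ ×ˢ {p | G.Adj p.1 p.2})) ?_ ?_ ?_
  · rintro G ⟨hG, hs⟩ ⟨v, u, a, b⟩ ⟨hv, ⟨ha, hav⟩, ⟨hb, hbv⟩, hab⟩
    dsimp only at hv ha hb hab hav hbv ⊢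
    have hr := hRsep G a ha b hb hab
    have hvu : G.Adj v u := (hv u).2 rfl
    refine ⟨hvu, hab, fun h => hr h.reachable,
      ⟨edgeSwap_mem_planarGraphs hG hvu hr (hRtree G a ha) (hRtree G b hb), ?_⟩, ?_, mem_univ _, ?_⟩
    · refine (ncard_isolatedVertices_le (G := G) {v, u} fun w hw z hz => ?_).trans
        (Nat.add_le_add hs (Finset.card_le_two))
      rw [edgeSwap_adj]
      refine Or.inl ⟨hz, fun h => hw ?_⟩
      have : w ∈ s(v, u) := h ▸ Sym2.mem_mk_left w z
      simpa using this
    · intro w hw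
      rw [edgeSwap_adj, Sym2.eq_iff] at hw
      rcases hw with ⟨h, h'⟩ | ⟨⟨h, -⟩ | ⟨-, h⟩, -⟩
      · exact h' (by rw [(hv w).1 h])
      · exact hav h
      · exact hbv h
    · change (G.edgeSwap v u a b).Adj a b
      rw [edgeSwap_adj]
      exact Or.inr ⟨rfl, hab⟩
  · rintro G ⟨hG, hs⟩
    have hleaf := G.two_mul_card_le_leaves
    have hR := hRcard G
    rw [Fintype.card_fin, hG.2] at hleaf hR
    choose! u hu using fun v (hv : v ∈ G.leaves) => hv
    let S : Finset (Σ _ : Fin n, Fin n × Fin n) :=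
      G.leaves.toFinset.sigma fun v => ((R G).erase v).offDiag
    have hS : (2 * (n - m) - 2 * s) * ((n - m - 1) * (n - m - 2)) ≤ S.card := by
      rw [Finset.card_sigma]
      calc (2 * (n - m) - 2 * s) * ((n - m - 1) * (n - m - 2))
          ≤ G.leaves.toFinset.card * ((n - m - 1) * (n - m - 2)) := by
            refine Nat.mul_le_mul_right _ ?_
            rw [← Set.ncard_eq_toFinset_card']
            omega
        _ ≤ _ := by
            rw [← smul_eq_mul (a := G.leaves.toFinset.card)]
            refine Finset.card_nsmul_le_sum _ _ _ fun v _ => ?_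
            rw [Finset.offDiag_card, ← Nat.mul_sub_one]
            have := Finset.pred_card_le_card_erase (s := R G) (a := v)
            exact Nat.mul_le_mul (by omega) (by omega)
    refine hS.trans ?_
    rw [← Set.ncard_coe_finset]
    refine Set.ncard_le_ncard_of_injOn (fun p => (p.1, u p.1, p.2.1, p.2.2)) ?_ ?_ (toFinite _)
    · rintro ⟨v, a, b⟩ h
      simp only [S, Finset.coe_sigma, Set.mem_sigma_iff, Finset.mem_coe, Set.mem_toFinset,
        Finset.mem_offDiag, Finset.mem_erase] at h
      exact ⟨hu v h.1, ⟨h.2.1.2, h.2.1.1⟩, ⟨h.2.2.1.2, h.2.2.1.1⟩, h.2.2.2⟩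
    · rintro ⟨v, a, b⟩ - ⟨v', a', b'⟩ - h
      simp only [Prod.mk.injEq] at h
      obtain ⟨rfl, -, rfl, rfl⟩ := h
      rfl
  · rintro G ⟨hG, hs⟩
    rw [Set.ncard_prod, Set.ncard_prod, ncard_adj_eq, hG.2, Set.ncard_univ, Nat.card_fin]
    exact Nat.mul_le_mul_right _ hs

/-- Counts the swaps that delete an edge `xy` and hang an isolated vertex `v` on the vertex `a` for `r`
in a copy of `H - l` not containing `x` and `y`. The quadruple `(x, y, a, v)` of a swap with result
`G'` is such that `v` stands for `l` in a copy of `H` in `G'`; then `a` is the only neighbour of `v`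
and need not be chosen. -/
theorem ncard_rootedCopies_step {W : Type*} [Finite W] {H : SimpleGraph W} (hH : H.IsTree)
    {l r : W} (hl : ∀ w, H.Adj l w ↔ w = r) (hr : r ∈ ({l}ᶜ : Set W))
    (hH' : (H.induce {l}ᶜ).IsTree) (n m s p q : ℕ) :
    {G ∈ planarGraphs n m | (rootedCopies H l G).ncard ≤ s ∧
        p ≤ (rootedCopies (H.induce {l}ᶜ) ⟨r, hr⟩ G).ncard ∧ q ≤ G.isolatedVertices.ncard}.ncard *
        (p * ((q - Nat.card W) * (2 * m - Nat.card W * Nat.card W))) ≤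
      {G ∈ planarGraphs n m | (rootedCopies H l G).ncard ≤ s + 4 * Nat.card W ∧
        p - 4 * Nat.card W ≤ (rootedCopies (H.induce {l}ᶜ) ⟨r, hr⟩ G).ncard ∧
        q - 4 * Nat.card W ≤ G.isolatedVertices.ncard}.ncard *
        ((s + 4 * Nat.card W) * (n * n)) := by
  classical
  have hW : 1 ≤ Nat.card W := Nat.card_pos_iff.2 ⟨⟨l⟩, inferInstance⟩
  have hW' : Nat.card ({l}ᶜ : Set W) ≤ Nat.card W :=
    Nat.card_le_card_of_injective _ Subtype.val_injective
  have hrange : ∀ ψ : ({l}ᶜ : Set W) → Fin n, (range ψ).ncard ≤ Nat.card W := fun ψ => by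
    rw [← image_univ]
    exact (Set.ncard_image_le (toFinite _)).trans (by rwa [Set.ncard_univ])
  refine ncard_mul_le_of_edgeSwap
    (fun G => {t | ∃ ψ : ({l}ᶜ : Set W) → Fin n, IsComponentCopy (H.induce {l}ᶜ) G ψ ∧
      ψ ⟨r, hr⟩ = t.2.2.1 ∧ t.2.2.2 ∈ G.isolatedVertices ∧ t.2.2.2 ∉ range ψ ∧
      G.Adj t.1 t.2.1 ∧ t.1 ∉ range ψ})
    (fun G => {t | t.2.2.2 ∈ rootedCopies H l G ∧ G.Adj t.2.2.2 t.2.2.1}) ?_ ?_ ?_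
  · rintro G ⟨hG, hs, hp, hq⟩ ⟨x, y, a, v⟩ ⟨ψ, hψ, ha, hv, hvψ, hxy, hx⟩
    dsimp only at ha hv hvψ hxy hx ⊢
    subst ha
    have hne : ψ ⟨r, hr⟩ ≠ v := fun h => hvψ ⟨_, h⟩
    have hnr : ¬ G.Reachable (ψ ⟨r, hr⟩) v := fun h => hvψ (hψ.mem_range_of_reachable ⟨_, rfl⟩ h)
    have hvtree : G.InTree v := by
      refine inTree_of_isAcyclic_induce (S := {v}) (fun u hu => ?_) IsAcyclic.of_subsingleton
      obtain ⟨w⟩ := hu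
      cases w with
      | nil => rfl
      | cons h _ => exact (hv _ h).elim
    let Z : Finset (Fin n) := {x, y, ψ ⟨r, hr⟩, v}
    have hZcard : Z.card ≤ 4 := Finset.card_le_four
    have hZ : ∀ u ∉ Z, ∀ w, (G.edgeSwap x y (ψ ⟨r, hr⟩) v).Adj u w ↔ G.Adj u w := fun u hu =>
      edgeSwap_adj_of_notMem (by simpa [Z] using hu)
    refine ⟨hxy, hne, fun h => hv _ h.symm,
      ⟨edgeSwap_mem_planarGraphs hG hxy hnr (hψ.inTree hH'.isAcyclic _) hvtree, ?_, ?_, ?_⟩, ?_, ?_⟩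
    · refine (ncard_rootedCopies_le hH.connected.preconnected l Z fun u hu w => (hZ u hu w).symm).trans
        (Nat.add_le_add hs (Nat.mul_le_mul_right _ hZcard))
    · rw [Nat.sub_le_iff_le_add]
      exact hp.trans ((ncard_rootedCopies_le hH'.connected.preconnected _ Z hZ).trans
        (Nat.add_le_add_left (Nat.mul_le_mul hZcard hW') _))
    · rw [Nat.sub_le_iff_le_add]
      refine hq.trans ((ncard_isolatedVertices_le Z fun u hu w => (hZ u hu w).1).trans
        (Nat.add_le_add_left ?_ _))
      omega
    · exact hψ.exists_edgeSwap hl hr hv hvψ hxy hx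
    · change (G.edgeSwap x y (ψ ⟨r, hr⟩) v).Adj v (ψ ⟨r, hr⟩)
      rw [edgeSwap_adj]
      exact Or.inr ⟨Sym2.eq_swap, hne.symm⟩
  · rintro G ⟨hG, hs, hp, hq⟩
    have hex : ∀ a, ∃ ψ : ({l}ᶜ : Set W) → Fin n,
        a ∈ rootedCopies (H.induce {l}ᶜ) ⟨r, hr⟩ G →
          IsComponentCopy (H.induce {l}ᶜ) G ψ ∧ ψ ⟨r, hr⟩ = a := fun a => by
      by_cases ha : a ∈ rootedCopies (H.induce {l}ᶜ) ⟨r, hr⟩ G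
      · exact ha.imp fun ψ hψ _ => hψ
      · exact ⟨fun _ => a, fun h => (ha h).elim⟩
    choose ψ hψ using hex
    let S : Finset (Σ _ : Fin n, Fin n × (Fin n × Fin n)) :=
      (rootedCopies (H.induce {l}ᶜ) ⟨r, hr⟩ G).toFinset.sigma fun a =>
        (G.isolatedVertices \ range (ψ a)).toFinset ×ˢ
          ({e : Fin n × Fin n | G.Adj e.1 e.2} \ (range (ψ a) ×ˢ range (ψ a))).toFinset
    have hS : p * ((q - Nat.card W) * (2 * m - Nat.card W * Nat.card W)) ≤ S.card := by
      rw [Finset.card_sigma]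
      calc p * ((q - Nat.card W) * (2 * m - Nat.card W * Nat.card W))
          ≤ (rootedCopies (H.induce {l}ᶜ) ⟨r, hr⟩ G).toFinset.card *
            ((q - Nat.card W) * (2 * m - Nat.card W * Nat.card W)) := by
            refine Nat.mul_le_mul_right _ ?_
            rwa [← Set.ncard_eq_toFinset_card']
        _ ≤ _ := by
            rw [← smul_eq_mul (a := (rootedCopies (H.induce {l}ᶜ) ⟨r, hr⟩ G).toFinset.card)]
            refine Finset.card_nsmul_le_sum _ _ _ fun a _ => ?_
            rw [Finset.card_product, ← Set.ncard_eq_toFinset_card', ← Set.ncard_eq_toFinset_card']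
            refine Nat.mul_le_mul ?_ ?_
            · exact (tsub_le_tsub hq (hrange _)).trans (Set.le_ncard_sdiff _ _)
            · refine le_trans ?_ (Set.le_ncard_sdiff _ _)
              rw [ncard_adj_eq, hG.2, Set.ncard_prod]
              exact Nat.sub_le_sub_left (Nat.mul_le_mul (hrange _) (hrange _)) _
    refine hS.trans ?_
    rw [← Set.ncard_coe_finset]
    refine Set.ncard_le_ncard_of_injOn (fun t => (t.2.2.1, t.2.2.2, t.1, t.2.1)) ?_ ?_ (toFinite _)
    · rintro ⟨a, v, x, y⟩ h
      simp only [S, Finset.coe_sigma, Set.mem_sigma_iff, Finset.mem_coe, Set.mem_toFinset,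
        Finset.mem_product, Set.mem_sdiff, Set.mem_ofPred_eq, Set.mem_prod] at h
      obtain ⟨ha, ⟨hv, hvψ⟩, hxy, hxyψ⟩ := h
      refine ⟨ψ a, (hψ a ha).1, (hψ a ha).2, hv, hvψ, hxy, fun hx => hxyψ ⟨hx, ?_⟩⟩
      exact (hψ a ha).1.mem_range_of_reachable hx hxy.reachable
    · rintro ⟨a, v, x, y⟩ - ⟨a', v', x', y'⟩ - h
      simp only [Prod.mk.injEq] at h
      obtain ⟨rfl, rfl, rfl, rfl⟩ := h
      rfl
  · rintro G ⟨hG, hs, -, -⟩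
    calc _ ≤ (rootedCopies H l G ×ˢ (univ : Set (Fin n × Fin n))).ncard := by
          refine Set.ncard_le_ncard_of_injOn (fun t => (t.2.2.2, t.1, t.2.1))
            (fun t ht => ⟨ht.1, mem_univ _⟩) ?_ (toFinite _)
          rintro ⟨x, y, a, v⟩ ⟨⟨φ, hφ, hφv⟩, hav⟩ ⟨x', y', a', v'⟩ ⟨-, hav'⟩ h
          simp only [Prod.mk.injEq] at h
          obtain ⟨rfl, rfl, rfl⟩ := h
          dsimp only at hφv hav hav'
          have key : ∀ b, G.Adj v b → b = φ r := by
            intro b hb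
            rw [← hφv, hφ.adj_iff] at hb
            obtain ⟨w, hw, rfl⟩ := hb
            rw [(hl w).1 hw]
          rw [key a hav, key a' hav']
      _ ≤ _ := by
          rw [Set.ncard_prod, Set.ncard_univ, Nat.card_prod, Nat.card_fin]
          exact Nat.mul_le_mul_right _ hs

/-! ### Abundance -/

/-- Outside an exponentially small proportion of `planarGraphs n m`, the parameter `N` is at least
linear in `n`, uniformly over `c * n ≤ m ≤ A * n`. -/
def LinearlyAbundant (c A : ℝ) (N : ∀ n : ℕ, SimpleGraph (Fin n) → ℕ) : Prop :=
  ∃ lam : ℝ, 0 < lam ∧ ∀ᶠ n : ℕ in Filter.atTop, ∀ m : ℕ, c * n ≤ m → m ≤ A * n →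
    ({G ∈ planarGraphs n m | (N n G : ℝ) < lam * n}.ncard : ℝ) ≤
      Real.exp (-(lam * n)) * (planarGraphs n m).ncard

namespace LinearlyAbundant

variable {c A : ℝ} {N N' : ∀ n : ℕ, SimpleGraph (Fin n) → ℕ}

/-- The bound persists for all smaller constants, so that several parameters can share one. -/
lemma exists_forall_le (h : LinearlyAbundant c A N) :
    ∃ rho : ℝ, 0 < rho ∧ ∀ lam : ℝ, 0 < lam → lam ≤ rho →
      ∀ᶠ n : ℕ in Filter.atTop, ∀ m : ℕ, c * n ≤ m → m ≤ A * n →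
        ({G ∈ planarGraphs n m | (N n G : ℝ) < lam * n}.ncard : ℝ) ≤
          Real.exp (-(lam * n)) * (planarGraphs n m).ncard := by
  obtain ⟨rho, hrho, h⟩ := h
  refine ⟨rho, hrho, fun lam _ hle => ?_⟩
  filter_upwards [h] with n hn m hc hA
  have hle' : lam * n ≤ rho * n := mul_le_mul_of_nonneg_right hle n.cast_nonneg
  calc ({G ∈ planarGraphs n m | (N n G : ℝ) < lam * n}.ncard : ℝ)
      ≤ ({G ∈ planarGraphs n m | (N n G : ℝ) < rho * n}.ncard : ℝ) := by
        exact Nat.cast_le.2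
          (Set.ncard_le_ncard (fun G hG => ⟨hG.1, hG.2.trans_le hle'⟩) (toFinite _))
    _ ≤ _ := hn m hc hA
    _ ≤ _ := by gcongr

lemma of_le_mul (h : LinearlyAbundant c A N) (k : ℕ) (hk : 0 < k)
    (hle : ∀ n G, N n G ≤ N' n G * k) : LinearlyAbundant c A N' := by
  obtain ⟨lam, hlam, h⟩ := h
  have hk' : (1 : ℝ) ≤ k := by exact_mod_cast hk
  have hdiv : lam / k ≤ lam := div_le_self hlam.le hk'
  refine ⟨lam / k, by positivity, ?_⟩
  filter_upwards [h] with n hn m hc hA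
  have hle' : lam / k * n ≤ lam * n := mul_le_mul_of_nonneg_right hdiv n.cast_nonneg
  calc ({G ∈ planarGraphs n m | (N' n G : ℝ) < lam / k * n}.ncard : ℝ)
      ≤ ({G ∈ planarGraphs n m | (N n G : ℝ) < lam * n}.ncard : ℝ) := by
        refine Nat.cast_le.2 (Set.ncard_le_ncard (fun G hG => ⟨hG.1, ?_⟩) (toFinite _))
        calc (N n G : ℝ) ≤ N' n G * k := by exact_mod_cast hle n G
          _ < lam / k * n * k := by
            have := hG.2
            gcongr
          _ = lam * n := by field_simp
    _ ≤ _ := hn m hc hA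
    _ ≤ _ := by gcongr

end LinearlyAbundant

/-- A chain of `T ≥ lam * n` sets, each at least `8 > e²` times larger than the previous one. -/
lemma ncard_le_exp_mul_of_chain {Ω : Type*} [Finite Ω] {P : Set Ω} (X : ℕ → Set Ω) (T : ℕ)
    {x : ℝ} (hx : x ≤ T) (hXP : X T ⊆ P)
    (hstep : ∀ t < T, 8 * ((X t).ncard : ℝ) ≤ (X (t + 1)).ncard) :
    ((X 0).ncard : ℝ) ≤ Real.exp (-(2 * x)) * P.ncard := by
  have hpow : ∀ t ≤ T, 8 ^ t * ((X 0).ncard : ℝ) ≤ (X t).ncard := by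
    intro t
    induction t with
    | zero => intro _; simp
    | succ t ih =>
      intro ht
      calc 8 ^ (t + 1) * ((X 0).ncard : ℝ) = 8 * (8 ^ t * ((X 0).ncard : ℝ)) := by ring
        _ ≤ 8 * (X t).ncard := by have := ih (by omega); gcongr
        _ ≤ _ := hstep t (by omega)
  have he : Real.exp (2 * x) ≤ 8 ^ T := by
    have h1 : Real.exp 2 ≤ 8 := by
      have h2 : Real.exp 2 = Real.exp 1 * Real.exp 1 := by rw [← Real.exp_add]; norm_num
      have h3 := Real.exp_one_lt_d9
      have h4 := Real.exp_pos 1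
      rw [h2]
      nlinarith
    calc Real.exp (2 * x) ≤ Real.exp (T * 2) := Real.exp_le_exp.2 (by linarith)
      _ = Real.exp 2 ^ T := Real.exp_nat_mul 2 T
      _ ≤ 8 ^ T := by gcongr
  have hP : ((X T).ncard : ℝ) ≤ P.ncard := by exact_mod_cast Set.ncard_le_ncard hXP (toFinite _)
  rw [Real.exp_neg, ← div_eq_inv_mul, le_div_iff₀ (Real.exp_pos _)]
  calc ((X 0).ncard : ℝ) * Real.exp (2 * x) ≤ (X 0).ncard * 8 ^ T := by gcongr
    _ = 8 ^ T * (X 0).ncard := mul_comm _ _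
    _ ≤ (X T).ncard := hpow T le_rfl
    _ ≤ P.ncard := hP

lemma eight_mul_le_of_mul_le {x y f b : ℕ} {B : ℝ} (h : x * f ≤ y * b) (hB : 0 < B)
    (hb : (b : ℝ) ≤ B) (hf : 8 * B ≤ f) : 8 * (x : ℝ) ≤ y := by
  have h' : (x : ℝ) * f ≤ y * b := by exact_mod_cast h
  refine le_of_mul_le_mul_right ?_ hB
  calc 8 * (x : ℝ) * B = x * (8 * B) := by ring
    _ ≤ x * f := by gcongr
    _ ≤ y * b := h'
    _ ≤ y * B := by gcongr

lemma eventually_le_mul_natCast {a : ℝ} (ha : 0 < a) (C : ℝ) :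
    ∀ᶠ n : ℕ in Filter.atTop, C ≤ a * n :=
  (tendsto_natCast_atTop_atTop.const_mul_atTop ha).eventually_ge_atTop C

/-- The guarantee of `n - m` tree components depends on `n` and `m` only, so it never wears off along
the chain of swaps. -/
theorem linearlyAbundant_isolatedVertices (c : ℝ) {A : ℝ} (hA : A < 1) :
    LinearlyAbundant c A fun _ G => G.isolatedVertices.ncard := by
  let α : ℝ := min (1 - A) 1
  have hα : 0 < α := lt_min (by linarith) one_pos
  have hα1 : α ≤ 1 := min_le_right _ _
  have hαA : α ≤ 1 - A := min_le_left _ _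
  -- makes the backward count `8 * lam * n ^ 3` an eighth of the forward count `α ^ 3 * n ^ 3 / 4`
  let lam : ℝ := α ^ 3 / 256
  have hlam : 0 < lam := by positivity
  have hlamα : 8 * lam ≤ α := by
    have : α ^ 3 ≤ α := by nlinarith [mul_nonneg hα.le (sub_nonneg.2 hα1)]
    simp only [lam]
    linarith
  refine ⟨lam, hlam, ?_⟩
  filter_upwards [eventually_le_mul_natCast hlam 2, eventually_le_mul_natCast hα 4]
    with n hn1 hn2 m _ hmA
  have hn0 : (0 : ℝ) < n := by
    by_contra h
    have : (n : ℝ) = 0 := le_antisymm (not_lt.1 h) n.cast_nonneg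
    rw [this] at hn1
    linarith
  have hmn : (m : ℝ) ≤ n - α * n := by nlinarith
  have hmn' : m ≤ n := by
    have : (m : ℝ) ≤ n := by nlinarith
    exact_mod_cast this
  have hdiff : α * n ≤ ((n - m : ℕ) : ℝ) := by
    rw [Nat.cast_sub hmn']
    linarith
  let T : ℕ := ⌈lam * n⌉₊
  have hT : (T : ℝ) < lam * n + 1 := Nat.ceil_lt_add_one (by positivity)
  let X : ℕ → Set (SimpleGraph (Fin n)) := fun t =>
    {G ∈ planarGraphs n m | G.isolatedVertices.ncard ≤ ⌊lam * n⌋₊ + 2 * t}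
  have hchain := ncard_le_exp_mul_of_chain (P := planarGraphs n m) X T (Nat.le_ceil (lam * n))
    (fun G hG => hG.1) (fun t ht => by
      have hs : ((⌊lam * n⌋₊ + 2 * t + 2 : ℕ) : ℝ) ≤ 4 * lam * n := by
        have h1 : ((⌊lam * n⌋₊ : ℕ) : ℝ) ≤ lam * n := Nat.floor_le (by positivity)
        have h2 : ((t + 1 : ℕ) : ℝ) ≤ T := Nat.cast_le.2 ht
        push_cast at h2 ⊢
        linarith
      refine eight_mul_le_of_mul_le (B := 8 * lam * n ^ 3)
        (ncard_isolatedVertices_step n m (⌊lam * n⌋₊ + 2 * t)) (by positivity) ?_ ?_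
      · push_cast at hs ⊢
        calc ((⌊lam * n⌋₊ : ℝ) + 2 * t + 2) * (n * (2 * m)) ≤ 4 * lam * n * (n * (2 * n)) := by
              have : (m : ℝ) ≤ n := by exact_mod_cast hmn'
              gcongr
          _ = _ := by ring
      · have h1 : α * n ≤ ((2 * (n - m) - 2 * (⌊lam * n⌋₊ + 2 * t) : ℕ) : ℝ) := by
          have h3 : 2 * (((n - m : ℕ) : ℝ)) - 2 * ((⌊lam * n⌋₊ + 2 * t + 2 : ℕ) : ℝ) ≤
              ((2 * (n - m) - 2 * (⌊lam * n⌋₊ + 2 * t) : ℕ) : ℝ) := by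
            rw [sub_le_iff_le_add]
            exact_mod_cast (by omega : 2 * (n - m) ≤
              2 * (n - m) - 2 * (⌊lam * n⌋₊ + 2 * t) + 2 * (⌊lam * n⌋₊ + 2 * t + 2))
          nlinarith
        have h2 : ∀ j : ℕ, j ≤ 2 → α * n / 2 ≤ ((n - m - j : ℕ) : ℝ) := by
          intro j hj
          have h3 : ((n - m : ℕ) : ℝ) - 2 ≤ ((n - m - j : ℕ) : ℝ) := by
            rw [sub_le_iff_le_add]
            exact_mod_cast (by omega : n - m ≤ n - m - j + 2)
          linarith
        calc 8 * (8 * lam * n ^ 3) = α * n * ((α * n / 2) * (α * n / 2)) := by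
              simp only [lam]; ring
          _ ≤ _ := by
              rw [Nat.cast_mul, Nat.cast_mul]
              have := h2 1 (by norm_num)
              have := h2 2 le_rfl
              gcongr)
  calc ({G ∈ planarGraphs n m | (G.isolatedVertices.ncard : ℝ) < lam * n}.ncard : ℝ)
      ≤ ((X 0).ncard : ℝ) := by
        refine Nat.cast_le.2 (Set.ncard_le_ncard (fun G hG => ⟨hG.1, ?_⟩) (toFinite _))
        rw [mul_zero, add_zero]
        exact Nat.le_floor hG.2.le
    _ ≤ Real.exp (-(2 * (lam * n))) * (planarGraphs n m).ncard := hchain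
    _ ≤ _ := by
        refine mul_le_mul_of_nonneg_right (Real.exp_le_exp.2 ?_) (Nat.cast_nonneg _)
        linarith

/-- If the components isomorphic to `H - l` are abundant, then so are those isomorphic to `H`. Along
the chain the bound on the copies of `H` rises, and the guaranteed numbers of copies of `H - l` and
of isolated vertices drop, by `4 * |W|` in each step. -/
theorem linearlyAbundant_rootedCopies {W : Type*} [Finite W] {H : SimpleGraph W} (hH : H.IsTree)
    {l r : W} (hl : ∀ w, H.Adj l w ↔ w = r) (hr : r ∈ ({l}ᶜ : Set W))
    (hH' : (H.induce {l}ᶜ).IsTree) {c A : ℝ} (hc : 0 < c) (hA : A < 1)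
    (hab : LinearlyAbundant c A fun _ G =>
      (rootedCopies (H.induce {l}ᶜ) (⟨r, hr⟩ : ({l}ᶜ : Set W)) G).ncard) :
    LinearlyAbundant c A fun _ G => (rootedCopies H l G).ncard := by
  obtain ⟨rho₁, hrho₁, h₁⟩ := hab.exists_forall_le
  obtain ⟨rho₂, hrho₂, h₂⟩ := (linearlyAbundant_isolatedVertices c hA).exists_forall_le
  let rho : ℝ := min rho₁ rho₂
  have hrho : 0 < rho := lt_min hrho₁ hrho₂
  let h : ℕ := Nat.card W
  let K : ℝ := 4 * h
  have hh : (1 : ℝ) ≤ h := by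
    exact_mod_cast (Nat.card_pos_iff.2 ⟨⟨l⟩, inferInstance⟩ : 0 < Nat.card W)
  have hK : 4 ≤ K := by simp only [K]; linarith
  -- the first bound limits the loss of copies of `H - l` and of isolated vertices along the chain,
  -- the second one compares the backward count with the forward count
  let lam : ℝ := min (rho / (4 * K)) (rho ^ 2 * c / (32 * (1 + 2 * K)))
  have hlam : 0 < lam := lt_min (by positivity) (by positivity)
  have hlam1 : K * lam ≤ rho / 4 := by
    calc K * lam ≤ K * (rho / (4 * K)) := by gcongr; exact min_le_left _ _
      _ = rho / 4 := by field_simp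
  have hlam2 : 8 * ((1 + 2 * K) * lam) ≤ rho ^ 2 * c / 4 := by
    calc 8 * ((1 + 2 * K) * lam) ≤ 8 * ((1 + 2 * K) * (rho ^ 2 * c / (32 * (1 + 2 * K)))) := by
          gcongr; exact min_le_right _ _
      _ = rho ^ 2 * c / 4 := by field_simp; norm_num
  have hlam3 : 2 * lam ≤ rho := by nlinarith
  refine ⟨lam, hlam, ?_⟩
  filter_upwards [h₁ rho hrho (min_le_left _ _), h₂ rho hrho (min_le_right _ _),
    eventually_le_mul_natCast hlam 2, eventually_le_mul_natCast hrho (4 * (K + h)),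
    eventually_le_mul_natCast hc (h * h)] with n hn₁ hn₂ hn3 hn4 hn5 m hmc hmA
  have hn0 : (0 : ℝ) < n := by
    by_contra h
    have : (n : ℝ) = 0 := le_antisymm (not_lt.1 h) n.cast_nonneg
    rw [this] at hn3
    linarith
  let T : ℕ := ⌈lam * n⌉₊
  have hT : (T : ℝ) < lam * n + 1 := Nat.ceil_lt_add_one (by positivity)
  have hKT : K * T ≤ rho * n / 4 + K := by nlinarith
  let X : ℕ → Set (SimpleGraph (Fin n)) := fun t =>
    {G ∈ planarGraphs n m | (rootedCopies H l G).ncard ≤ ⌊lam * n⌋₊ + t * (4 * h) ∧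
      ⌈rho * n⌉₊ - t * (4 * h) ≤ (rootedCopies (H.induce {l}ᶜ) ⟨r, hr⟩ G).ncard ∧
      ⌈rho * n⌉₊ - t * (4 * h) ≤ G.isolatedVertices.ncard}
  have hchain := ncard_le_exp_mul_of_chain (P := planarGraphs n m) X T (Nat.le_ceil (lam * n))
    (fun G hG => hG.1) (fun t ht => by
      have ht' : (t : ℝ) + 1 ≤ T := by exact_mod_cast ht
      have htK : t * K + K ≤ K * T := by nlinarith
      have hstep := ncard_rootedCopies_step hH hl hr hH' n m (⌊lam * n⌋₊ + t * (4 * h))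
        (⌈rho * n⌉₊ - t * (4 * h)) (⌈rho * n⌉₊ - t * (4 * h))
      have e : (t + 1) * (4 * h) = t * (4 * h) + 4 * Nat.card W := by simp only [h]; ring
      have e₁ : ⌊lam * n⌋₊ + t * (4 * h) + 4 * Nat.card W = ⌊lam * n⌋₊ + (t + 1) * (4 * h) := by
        omega
      have e₂ : ⌈rho * n⌉₊ - t * (4 * h) - 4 * Nat.card W = ⌈rho * n⌉₊ - (t + 1) * (4 * h) := by
        omega
      rw [e₁, e₂] at hstep
      refine eight_mul_le_of_mul_le (B := (1 + 2 * K) * lam * n ^ 3) hstep (by positivity) ?_ ?_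
      · have h1 : ((⌊lam * n⌋₊ : ℕ) : ℝ) ≤ lam * n := Nat.floor_le (by positivity)
        have h2 : ((⌊lam * n⌋₊ + (t + 1) * (4 * h) : ℕ) : ℝ) ≤ (1 + 2 * K) * lam * n := by
          push_cast
          change (⌊lam * n⌋₊ : ℝ) + (t + 1) * K ≤ _
          nlinarith
        rw [Nat.cast_mul, Nat.cast_mul]
        calc _ ≤ (1 + 2 * K) * lam * n * ((n : ℝ) * n) := by gcongr
          _ = _ := by ring
      · have hp : rho * n / 2 + h ≤ ((⌈rho * n⌉₊ - t * (4 * h) : ℕ) : ℝ) := by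
          have h1 := Nat.le_ceil (rho * n)
          have h2 : (⌈rho * n⌉₊ : ℝ) ≤ ((⌈rho * n⌉₊ - t * (4 * h) : ℕ) : ℝ) + t * K := by
            have : (⌈rho * n⌉₊ : ℝ) ≤
                ((⌈rho * n⌉₊ - t * (4 * h) : ℕ) : ℝ) + ((t * (4 * h) : ℕ) : ℝ) := by
              exact_mod_cast (by omega : ⌈rho * n⌉₊ ≤ ⌈rho * n⌉₊ - t * (4 * h) + t * (4 * h))
            push_cast at this
            exact this
          linarith
        have hq : rho * n / 2 ≤ ((⌈rho * n⌉₊ - t * (4 * h) - h : ℕ) : ℝ) := by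
          have : ((⌈rho * n⌉₊ - t * (4 * h) : ℕ) : ℝ) ≤
              ((⌈rho * n⌉₊ - t * (4 * h) - h : ℕ) : ℝ) + h := by
            exact_mod_cast le_tsub_add
          linarith
        have hm : c * n ≤ ((2 * m - h * h : ℕ) : ℝ) := by
          have : ((2 * m : ℕ) : ℝ) ≤ ((2 * m - h * h : ℕ) : ℝ) + ((h * h : ℕ) : ℝ) := by
            exact_mod_cast le_tsub_add
          push_cast at this
          linarith
        have hp' : rho * n / 2 ≤ ((⌈rho * n⌉₊ - t * (4 * h) : ℕ) : ℝ) := by linarith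
        rw [Nat.cast_mul, Nat.cast_mul]
        calc 8 * ((1 + 2 * K) * lam * n ^ 3) = 8 * ((1 + 2 * K) * lam) * n ^ 3 := by ring
          _ ≤ rho ^ 2 * c / 4 * n ^ 3 := by gcongr
          _ = rho * n / 2 * (rho * n / 2 * (c * n)) := by ring
          _ ≤ _ := by gcongr)
  have hsub : {G ∈ planarGraphs n m | ((rootedCopies H l G).ncard : ℝ) < lam * n} ⊆
      X 0 ∪ ({G ∈ planarGraphs n m |
          ((rootedCopies (H.induce {l}ᶜ) ⟨r, hr⟩ G).ncard : ℝ) < rho * n} ∪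
        {G ∈ planarGraphs n m | (G.isolatedVertices.ncard : ℝ) < rho * n}) := by
    rintro G ⟨hG, hlt⟩
    by_cases k₁ : ((rootedCopies (H.induce {l}ᶜ) ⟨r, hr⟩ G).ncard : ℝ) < rho * n
    · exact Or.inr (Or.inl ⟨hG, k₁⟩)
    by_cases k₂ : (G.isolatedVertices.ncard : ℝ) < rho * n
    · exact Or.inr (Or.inr ⟨hG, k₂⟩)
    refine Or.inl ⟨hG, ?_, ?_, ?_⟩
    · rw [zero_mul, add_zero]; exact Nat.le_floor hlt.le
    · rw [zero_mul, Nat.sub_zero]; exact Nat.ceil_le.2 (not_lt.1 k₁)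
    · rw [zero_mul, Nat.sub_zero]; exact Nat.ceil_le.2 (not_lt.1 k₂)
  have hcard : ({G ∈ planarGraphs n m | ((rootedCopies H l G).ncard : ℝ) < lam * n}.ncard : ℝ) ≤
      (X 0).ncard + (({G ∈ planarGraphs n m |
          ((rootedCopies (H.induce {l}ᶜ) ⟨r, hr⟩ G).ncard : ℝ) < rho * n}.ncard : ℝ) +
        ({G ∈ planarGraphs n m | (G.isolatedVertices.ncard : ℝ) < rho * n}.ncard : ℝ)) := by
    have := (Set.ncard_le_ncard hsub (toFinite _)).trans ((Set.ncard_union_le _ _).trans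
      (Nat.add_le_add_left (Set.ncard_union_le _ _) _))
    exact_mod_cast this
  have hb₁ := hn₁ m hmc hmA
  have hb₂ := hn₂ m hmc hmA
  have hexp : Real.exp (-(rho * n)) ≤ Real.exp (-(2 * (lam * n))) :=
    Real.exp_le_exp.2 (by nlinarith)
  have hexp3 : 3 * Real.exp (-(2 * (lam * n))) ≤ Real.exp (-(lam * n)) := by
    have e1 : Real.exp (-(lam * n)) = Real.exp (lam * n) * Real.exp (-(2 * (lam * n))) := by
      rw [← Real.exp_add]; congr 1; ring
    have e2 : 3 ≤ Real.exp (lam * n) := by linarith [Real.add_one_le_exp (lam * n)]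
    rw [e1]
    gcongr
  have hP : (0 : ℝ) ≤ (planarGraphs n m).ncard := Nat.cast_nonneg _
  have hexpP := mul_le_mul_of_nonneg_right hexp hP
  have hexp3P := mul_le_mul_of_nonneg_right hexp3 hP
  linarith

/-- Induction on the number of vertices of the tree `H`, removing a leaf. -/
theorem linearlyAbundant_isoComponentCount {c A : ℝ} (hc : 0 < c) (hA : A < 1) (k : ℕ) :
    ∀ {W : Type*} [Finite W] (H : SimpleGraph W), H.IsTree → Nat.card W = k →
      LinearlyAbundant c A fun _ G => isoComponentCount H G := by
  classical
  induction k with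
  | zero =>
    intro W _ H hH hk
    have := hH.connected.nonempty
    exact (Nat.card_pos.ne' hk).elim
  | succ k ih =>
    intro W _ H hH hk
    have hW := hH.connected.nonempty
    cases nonempty_fintype W
    rcases subsingleton_or_nontrivial W with hs | hs
    · obtain ⟨r⟩ := id hW
      refine (linearlyAbundant_isolatedVertices c hA).of_le_mul (Nat.card W) Nat.card_pos
        fun n G => le_trans (Set.ncard_le_ncard (fun a ha => ?_) (toFinite _))
          (ncard_rootedCopies_le_isoComponentCount hH.connected.preconnected r G)
      refine ⟨fun _ => a, ⟨Function.injective_of_subsingleton _, fun x v => ?_⟩, rfl⟩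
      refine ⟨fun h => (ha v h).elim, ?_⟩
      rintro ⟨y, hy, -⟩
      exact (hy.ne (Subsingleton.elim _ _)).elim
    · obtain ⟨l, hdeg⟩ := hH.exists_vert_degree_one_of_nontrivial
      have hconn := hH.connected.induce_compl_singleton_of_degree_eq_one hdeg
      have hH' : (H.induce {l}ᶜ).IsTree := ⟨hconn, hH.isAcyclic.induce _⟩
      obtain ⟨r, hadj, huniq⟩ := degree_eq_one_iff_existsUnique_adj.1 hdeg
      have hl : ∀ w, H.Adj l w ↔ w = r := fun w => ⟨huniq w, fun h => h ▸ hadj⟩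
      have hr : r ∈ ({l}ᶜ : Set W) := hadj.ne'
      have hcard : Nat.card ({l}ᶜ : Set W) = k := by
        rw [Nat.card_coe_set_eq, Set.ncard_compl, hk, Set.ncard_singleton, Nat.add_sub_cancel]
      have h₁ := (ih (H.induce {l}ᶜ) hH' hcard).of_le_mul 1 one_pos
        (N' := fun _ G => (rootedCopies (H.induce {l}ᶜ) (⟨r, hr⟩ : ({l}ᶜ : Set W)) G).ncard)
        fun n G => by
          rw [mul_one]; exact isoComponentCount_le_ncard_rootedCopies _ _ G
      exact (linearlyAbundant_rootedCopies hH hl hr hH' hc hA h₁).of_le_mul (Nat.card W)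
        Nat.card_pos fun n G =>
          ncard_rootedCopies_le_isoComponentCount hH.connected.preconnected l G

/-! ### The theorem on components isomorphic to a tree -/

theorem theorem3p4 {W : Type*} [Finite W] (H : SimpleGraph W) (hH : H.IsTree)
    (c A : ℝ) (hc : 0 < c) (hA : A < 1) :
    ∃ lam : ℝ, 0 < lam ∧
      ∀ m : ℕ → ℕ,
        (∀ᶠ n : ℕ in Filter.atTop, c * (n : ℝ) ≤ (m n : ℝ) ∧ (m n : ℝ) ≤ A * (n : ℝ)) →
        ∀ᶠ n : ℕ in Filter.atTop,
          (planarGraphs n (m n)).Nonempty ∧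
          planarProb n (m n) (fun G => (isoComponentCount H G : ℝ) < lam * (n : ℝ))
            < Real.exp (-(lam * (n : ℝ))) := by
  obtain ⟨rho, hrho, h⟩ := linearlyAbundant_isoComponentCount hc hA _ H hH rfl
  refine ⟨rho / 2, by positivity, fun m hm => ?_⟩
  filter_upwards [hm, h, eventually_le_mul_natCast one_pos 1] with n ⟨hmc, hmA⟩ hn hn1
  rw [one_mul] at hn1
  have hlt : m n < n := by
    have : (m n : ℝ) < n := by nlinarith
    exact_mod_cast this
  have hne := planarGraphs_nonempty hlt
  have hpos : (0 : ℝ) < (planarGraphs n (m n)).ncard := by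
    exact_mod_cast (Set.ncard_pos (toFinite _)).2 hne
  refine ⟨hne, ?_⟩
  rw [planarProb, div_lt_iff₀ hpos]
  calc ({G ∈ planarGraphs n (m n) | (isoComponentCount H G : ℝ) < rho / 2 * n}.ncard : ℝ)
      ≤ ({G ∈ planarGraphs n (m n) | (isoComponentCount H G : ℝ) < rho * n}.ncard : ℝ) := by
        refine Nat.cast_le.2 (Set.ncard_le_ncard (fun G hG => ⟨hG.1, hG.2.trans_le ?_⟩) (toFinite _))
        nlinarith
    _ ≤ Real.exp (-(rho * n)) * (planarGraphs n (m n)).ncard := hn _ hmc hmA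
    _ < Real.exp (-(rho / 2 * n)) * (planarGraphs n (m n)).ncard := by
        gcongr
        nlinarith
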